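/- **Setting.** Let $\lambda>0$, $R>0$, and let $\mathcal L$ be a probability measure on $\mathbb R_+$ with finite mean. A *landscape* is a set $S\subset\mathbb R\times\mathbb R_+$ of buildings (base, height) with finitely many buildings above every bounded interval of bases. For a point $p=(x,y)\in\mathbb R\times\mathbb R_+$, the blocking building $\tau(p)=\tau(p,S)$ is the building $(a,b)\in S$ with $a\in\,]x,x+R]$ that maximizes the slope $\frac{b-y}{a-x}$ (the leftmost such building, if there are several), and $\tau(p)=(-\infty,-\infty)$ if no building of $S$ has its base in $]x,x+R]$; also $\tau(-\infty,-\infty)=(-\infty,-\infty)$. The zone of eventual relaying of a building $b$ is $\mathrm Z(b)=\mathrm Z(b,S)=\{p\in\mathbb R\times\mathbb R_+:\exists n\in\mathbb N,\ \tau^{(n)}(p,S)=b\}$, and its ground length $\ell(\mathrm Z(b))$ is the Lebesgue measure of $\{x\in\mathbb R:(x,0)\in \mathrm Z(b)\}$. Let $\mathrm L$ be a Poisson building process with intensity $\lambda$ and height distribution $\mathcal L$, i.e. a Poisson point process on $\mathbb R$ of intensity $\lambda$ with independent marks of law $\mathcal L$; equivalently, a Poisson point process on $\mathbb R\times\mathbb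 R_+$ with intensity measure $\lambda\,\mathrm{Leb}\otimes\mathcal L$. Let $H$ be a random variable of law $\mathcal L$, independent of $\mathrm L$, and $\tilde{\mathrm L}=\mathrm L\cup\{(0,H)\}$. The blockage chain started at the origin is $Y_0=(0,+\infty,0)$ and, with $(X_n,H_n)=\tau^{(n)}((0,0),\mathrm L)$, $$Y_n=\Bigl(X_n-X_{n-1},\ \tfrac{H_n-H_{n-1}}{X_n-X_{n-1}},\ H_n\Bigr)\quad (n\ge 1)$$ as long as $(X_n,H_n)\neq(-\infty,-\infty)$, and the cemetery state $Y_n=(-\infty,-\infty,-\infty)$ from then on. Let $T=\inf\{n\ge 0: Y_{n+1}=(-\infty,-\infty,-\infty)\}$ be the number of hops that the chain makes before it jumps to the cemetery state. **Proposition.** The ground length of $\mathrm Z((0,H),\tilde{\mathrm L})$ and $T$ are random variables up to null sets, and, as an identity in $[0,\infty]$, $$\mathbb E\bigl[\ell(\mathrm Z((0,H),\tilde{\mathrm L}))\bigr]=\frac1\lambda\,\mathbb E[T].$$ If moreover $\mathcal L$ has no atoms, then $$\mathbb E[T]=\sum_{n\ge1}\int_{(\mathbb R\times\mathbb R_+)^n}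 g_n\ \mathrm d(\mathrm{Leb}\otimes\mathcal L)^{\otimes n},$$ where, with $F$ the CDF of $\mathcal L$, $\mathfrak F(x)=-\int_x^\infty(1-F(u))\,\mathrm du$, $(x_0,h_0)=(0,0)$, $t_i=\frac{h_i-h_{i-1}}{x_i-x_{i-1}}$, $r_i=R-(x_i-x_{i-1})$, $m_i=t_i\wedge t_{i+1}$, $$g_n\bigl((x_i,h_i)_{1\le i\le n}\bigr)=\lambda^n e^{-\lambda E_n}\prod_{i=1}^n\mathbf 1_{x_i\in\,]x_{i-1},x_{i-1}+R]}\ \prod_{i=2}^n\mathbf 1_{t_i\le t_{i-1}\text{ or }x_i>x_{i-2}+R},$$ $$E_n=\frac{\mathfrak F(h_{n-1}+Rt_n)}{t_n}-\frac{\mathfrak F(h_0)}{t_1}+\sum_{i=1}^{n-1}\mathfrak F(h_i)\Bigl(\frac1{t_i}-\frac1{m_i}\Bigr)+\sum_{i=1}^{n-1}\Bigl(\frac{\mathfrak F(h_i+r_im_i)}{m_i}-\frac{\mathfrak F(h_i+r_it_{i+1})}{t_{i+1}}\Bigr).$$ -/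

import Mathlib

open MeasureTheory ProbabilityTheory
open scoped ENNReal

namespace Relay

/-! Geometry: landscapes, blockage with horizontal range `R`, zones of eventual relaying. -/

/-- A landscape: a set of buildings `(base, height)` in the half plane `ℝ × ℝ₊`, finitely many of
them over each bounded interval of bases. -/
def IsLandscape (S : Set (ℝ × ℝ)) : Prop :=
  (∀ q ∈ S, 0 ≤ q.2) ∧ ∀ a b : ℝ, {q ∈ S | a ≤ q.1 ∧ q.1 ≤ b}.Finite

/-- The slope from the point `p` to the point `q`. -/
noncomputable def slopeTo (p q : ℝ × ℝ) : ℝ := (q.2 - p.2) / (q.1 - p.1)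

/-- The buildings of `S` in horizontal range of `p`: those with base in `]x, x + R]`. -/
def inRange (R : ℝ) (S : Set (ℝ × ℝ)) (p : ℝ × ℝ) : Set (ℝ × ℝ) :=
  {q ∈ S | p.1 < q.1 ∧ q.1 ≤ p.1 + R}

/-- The argmax: buildings in range of `p` that have the largest slope as seen from `p`. -/
def maximizers (R : ℝ) (S : Set (ℝ × ℝ)) (p : ℝ × ℝ) : Set (ℝ × ℝ) :=
  {q ∈ inRange R S p | ∀ r ∈ inRange R S p, slopeTo p r ≤ slopeTo p q}

/-- `q` is the blocking building of `p`: the maximizer of the slope, and the leftmost one if there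
are several. -/
def IsBlocking (R : ℝ) (S : Set (ℝ × ℝ)) (p q : ℝ × ℝ) : Prop :=
  q ∈ maximizers R S p ∧ ∀ r ∈ maximizers R S p, q.1 ≤ r.1

theorem IsBlocking.unique {R : ℝ} {S : Set (ℝ × ℝ)} {p q r : ℝ × ℝ}
    (hq : IsBlocking R S p q) (hr : IsBlocking R S p r) : q = r := by
  have h1 : q.1 = r.1 := le_antisymm (hq.2 r hr.1) (hr.2 q hq.1)
  have h2 : slopeTo p q = slopeTo p r :=
    le_antisymm (hr.1.2 q hq.1.1) (hq.1.2 r hr.1.1)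
  have h3 : r.1 - p.1 ≠ 0 := (sub_pos.mpr hr.1.1.2.1).ne'
  have h4 : q.2 = r.2 := by
    unfold slopeTo at h2
    rw [h1, div_left_inj' h3] at h2
    linarith
  exact Prod.ext h1 h4

/-- In a landscape, a blocking building exists exactly when some building is in range. -/
theorem exists_isBlocking_iff {R : ℝ} {S : Set (ℝ × ℝ)} (hS : IsLandscape S) (p : ℝ × ℝ) :
    (∃ q, IsBlocking R S p q) ↔ (inRange R S p).Nonempty := by
  constructor
  · rintro ⟨q, hq⟩
    exact ⟨q, hq.1.1⟩
  · intro hne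
    have hfin : (inRange R S p).Finite :=
      (hS.2 p.1 (p.1 + R)).subset fun q hq => ⟨hq.1, hq.2.1.le, hq.2.2⟩
    obtain ⟨m, hm, hmax⟩ := Set.exists_max_image _ (slopeTo p) hfin hne
    have hfin' : (maximizers R S p).Finite := hfin.subset fun q hq => hq.1
    obtain ⟨q, hq, hmin⟩ := Set.exists_min_image _ Prod.fst hfin' ⟨m, hm, hmax⟩
    exact ⟨q, hq, hmin⟩

open Classical in
/-- The relaying scheme `τ`: the blocking building of `p` in `S`; `none` stands for
`(-∞, -∞)`, the value when no building is in range. -/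
noncomputable def block (R : ℝ) (S : Set (ℝ × ℝ)) (p : ℝ × ℝ) : Option (ℝ × ℝ) :=
  if h : ∃ q, IsBlocking R S p q then some h.choose else none

/-- The blockage sequence `τ⁽ⁿ⁾(p)`, which stays at `none` once it has reached it. -/
noncomputable def blockSeq (R : ℝ) (S : Set (ℝ × ℝ)) (p : ℝ × ℝ) : ℕ → Option (ℝ × ℝ)
  | 0 => some p
  | n + 1 => (blockSeq R S p n).bind (block R S)

/-- The zone of eventual relaying of `b`: the points of `ℝ × ℝ₊` eventually relayed by `b`. -/
def zone (R : ℝ) (S : Set (ℝ × ℝ)) (b : ℝ × ℝ) : Set (ℝ × ℝ) :=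
  {p | 0 ≤ p.2 ∧ ∃ n : ℕ, blockSeq R S p n = some b}

/-- The ground length of a subset of the half plane. -/
noncomputable def groundLength (Z : Set (ℝ × ℝ)) : ℝ≥0∞ :=
  volume {x : ℝ | (x, (0 : ℝ)) ∈ Z}

/-! The blockage chain `(x̃ₙ, tₙ, Hₙ)` of the point `(0, 0)`: length of the last hop, slope of the
last hop, and current height. -/

/-- The cemetery state. -/
noncomputable def cemetery : EReal × EReal × EReal := (⊥, ⊥, ⊥)

/-- The state reached by a hop between two consecutive terms of the blockage sequence. -/
noncomputable def hopState : Option (ℝ × ℝ) → Option (ℝ × ℝ) → EReal × EReal × EReal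
  | some p, some q => (((q.1 - p.1 : ℝ) : EReal), ((slopeTo p q : ℝ) : EReal), ((q.2 : ℝ) : EReal))
  | _, _ => cemetery

/-- The blockage chain started at the origin: hop length `0`, slope `+∞`, height `0`. -/
noncomputable def chain (R : ℝ) (S : Set (ℝ × ℝ)) : ℕ → EReal × EReal × EReal
  | 0 => (0, ⊤, 0)
  | n + 1 => hopState (blockSeq R S (0, 0) n) (blockSeq R S (0, 0) (n + 1))

/-- The number of hops that the chain makes before it jumps to the cemetery state: the least `n`
such that hop `n + 1` leads to the cemetery, and `∞` if there is none. -/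
noncomputable def hopsBeforeCemetery (R : ℝ) (S : Set (ℝ × ℝ)) : ℝ≥0∞ :=
  ⨅ (n : ℕ) (_ : chain R S (n + 1) = cemetery), (n : ℝ≥0∞)

/-! Random landscapes. -/

variable {Ω : Type*} [MeasurableSpace Ω]

/-- The number of buildings of the random landscape `L` in `B`. -/
noncomputable def count (L : Ω → Set (ℝ × ℝ)) (B : Set (ℝ × ℝ)) (ω : Ω) : ℕ∞ :=
  (L ω ∩ B).encard

/-- The σ-algebra generated by the random landscape `L`. -/
@[reducible] noncomputable def landscapeSigma (L : Ω → Set (ℝ × ℝ)) : MeasurableSpace Ω :=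
  ⨆ (B : Set (ℝ × ℝ)) (_ : MeasurableSet B), MeasurableSpace.comap (count L B) inferInstance

/-- Poisson building process with intensity `lam` and height distribution `ν`: a Poisson point
process on `ℝ` of rate `lam`, independently marked with law `ν`, that is, a Poisson point process
on the half plane with intensity measure `lam • (Leb ⊗ ν)`. -/
structure IsPoissonBuildingProcess (lam : ℝ) (ν : Measure ℝ) (P : Measure Ω)
    (L : Ω → Set (ℝ × ℝ)) : Prop where
  landscape : ∀ ω, IsLandscape (L ω)
  measurable_count : ∀ B : Set (ℝ × ℝ), MeasurableSet B → Measurable (count L B)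
  poisson : ∀ B : Set (ℝ × ℝ), MeasurableSet B → ((volume : Measure ℝ).prod ν) B ≠ ∞ →
    ∀ k : ℕ, P {ω | count L B ω = k} =
      ENNReal.ofReal (Real.exp (-(lam * (((volume : Measure ℝ).prod ν) B).toReal))
        * (lam * (((volume : Measure ℝ).prod ν) B).toReal) ^ k / (k.factorial : ℝ))
  indep : ∀ (n : ℕ) (B : Fin n → Set (ℝ × ℝ)), (∀ i, MeasurableSet (B i)) →
    Pairwise (Function.onFun Disjoint B) → iIndepFun (fun i => count L (B i)) P

/-! The density of the blockage sequence of `(0, 0)`. -/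

/-- The primitive of `1 - F` that vanishes at `+∞`, where `F` is the CDF of `ν`. -/
noncomputable def tailPrimitive (ν : Measure ℝ) (x : ℝ) : ℝ :=
  -∫ u in Set.Ioi x, (1 - cdf ν u)

/-- The sequence `(xᵢ, hᵢ)` with term `0` at the origin and terms `1, …, n` given by `p`. -/
noncomputable def fromOrigin {n : ℕ} (p : Fin n → ℝ × ℝ) (i : ℕ) : ℝ × ℝ :=
  if h : 1 ≤ i ∧ i ≤ n then p ⟨i - 1, by omega⟩ else (0, 0)

/-- The slope `tᵢ` of hop `i`, from point `i - 1` to point `i` (for `1 ≤ i`). -/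
noncomputable def hopSlope (q : ℕ → ℝ × ℝ) (i : ℕ) : ℝ := slopeTo (q (i - 1)) (q i)

/-- The range `rᵢ = R - (xᵢ - xᵢ₋₁)` left over after hop `i` (for `1 ≤ i`). -/
noncomputable def leftover (R : ℝ) (q : ℕ → ℝ × ℝ) (i : ℕ) : ℝ := R - ((q i).1 - (q (i - 1)).1)

/-- The bracket multiplied by `-lam` in the exponential of the density of `n ≥ 1` hops. -/
noncomputable def densityExponent (R : ℝ) (ν : Measure ℝ) (n : ℕ) (q : ℕ → ℝ × ℝ) : ℝ :=
  let G := tailPrimitive ν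
  let t := hopSlope q
  let r := leftover R q
  let h : ℕ → ℝ := fun i => (q i).2
  G (h (n - 1) + R * t n) / t n - G (h 0) / t 1
    + ∑ i ∈ Finset.Ico 1 n, G (h i) * (1 / t i - 1 / min (t i) (t (i + 1)))
    + ∑ i ∈ Finset.Ico 1 n,
        (G (h i + r i * min (t i) (t (i + 1))) / min (t i) (t (i + 1))
          - G (h i + r i * t (i + 1)) / t (i + 1))

/-- Each hop has length in `]0, R]`, and each point is in the shade of the preceding one as seen
from the one before. -/
def Admissible (R : ℝ) (n : ℕ) (q : ℕ → ℝ × ℝ) : Prop :=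
  (∀ i, 1 ≤ i → i ≤ n → (q (i - 1)).1 < (q i).1 ∧ (q i).1 ≤ (q (i - 1)).1 + R) ∧
  ∀ i, 2 ≤ i → i ≤ n → hopSlope q i ≤ hopSlope q (i - 1) ∨ (q (i - 2)).1 + R < (q i).1

open Classical in
/-- The density `gₙ` of the first `n ≥ 1` blocking buildings of `(0, 0)`, on the event that they
all exist, with respect to the `n`-th power of `Leb ⊗ ν`. -/
noncomputable def blockDensity (lam R : ℝ) (ν : Measure ℝ) (n : ℕ) (p : Fin n → ℝ × ℝ) : ℝ≥0∞ :=
  if Admissible R n (fromOrigin p) then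
    ENNReal.ofReal (lam ^ n * Real.exp (-(lam * densityExponent R ν n (fromOrigin p))))
  else 0

end Relay

/-! The blockage chain of a point `o` makes `n` hops exactly when some `n`-tuple of buildings, with
consecutive bases at distance in `]0, R]`, has no building in an attached region (`chainRegion`):
the points that would have beaten one of the chosen blocking buildings. Such a tuple is unique, so
the indicator of the event is the number of such tuples. The multivariate Mecke formula for void
regions (`IsPoissonBuildingProcess.lintegral_void`) then gives the expectation as `λⁿ` times the
integral of `chainWeight`, that is, of `exp(-λ · intensity of the region)` over the tuples that
avoid their own region.

For `E[T]`, `T` is the sum over `n` of the indicators that hop `n + 1` exists, which gives `Σ λⁿ⁺¹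
Iₙ₊₁`, where `Iₙ₊₁` is the integral for chains of `n + 1` buildings started at the origin. For the
ground length, a ground point `x` reaches `(0, h)` at hop `n + 1` through `n` buildings of the
process, and the last building is fixed; the formula therefore yields only `λⁿ`. Integrating over
`x` and `h` and translating the start to the origin makes the last building range over `Leb ⊗ ν`, so
the integral is again `Iₙ₊₁` (`lintegral_chainWeight_snoc`). The two series differ termwise by the
factor `λ`, and Tonelli makes the identity valid in `[0, ∞]`.

For the explicit density, in an admissible chain the regions of earlier hops are absorbed, beyond
the end of a hop, by the region of that hop. Each hop thus adds a region bounded by two lines, whose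
area is a difference of values of `tailPrimitive` divided by slopes; adding these up gives the
exponent (`Admissible.measureReal_chainRegion`). The absence of atoms makes the boundary lines and
the hops of slope zero negligible. -/

namespace Relay

/-! ### Monotone classes generated by an algebra of sets. -/

/-- The smallest class of sets that contains `A` and is closed under monotone limits. -/
inductive MonotoneClass {α : Type*} (A : Set (Set α)) : Set α → Prop
  | basic (s : Set α) : s ∈ A → MonotoneClass A s
  | iUnion (f : ℕ → Set α) : Monotone f → (∀ k, MonotoneClass A (f k)) →
      MonotoneClass A (⋃ k, f k)
  | iInter (f : ℕ → Set α) : Antitone f → (∀ k, MonotoneClass A (f k)) →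
      MonotoneClass A (⋂ k, f k)

namespace MonotoneClass

variable {α : Type*} {A : Set (Set α)}

theorem compl (hA : IsSetAlgebra A) {s : Set α} (hs : MonotoneClass A s) :
    MonotoneClass A sᶜ := by
  induction hs with
  | basic s hs => exact basic _ (hA.compl_mem hs)
  | iUnion f hf _ ih =>
    rw [Set.compl_iUnion]
    exact iInter _ (fun _ _ h => Set.compl_subset_compl.2 (hf h)) ih
  | iInter f hf _ ih =>
    rw [Set.compl_iInter]
    exact iUnion _ (fun _ _ h => Set.compl_subset_compl.2 (hf h)) ih

/-- Intersection with a fixed set commutes with monotone limits, so only generators need checking.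
`inter` uses this twice: with `t` in the algebra, then with `t` in the class. -/
theorem inter_right {t : Set α} (ht : ∀ a ∈ A, MonotoneClass A (a ∩ t)) {s : Set α}
    (hs : MonotoneClass A s) : MonotoneClass A (s ∩ t) := by
  induction hs with
  | basic s hs => exact ht s hs
  | iUnion f hf _ ih =>
    rw [Set.iUnion_inter]
    exact iUnion _ (fun _ _ h => Set.inter_subset_inter_left _ (hf h)) ih
  | iInter f hf _ ih =>
    rw [Set.iInter_inter]
    exact iInter _ (fun _ _ h => Set.inter_subset_inter_left _ (hf h)) ih

theorem inter (hA : IsSetAlgebra A) {s t : Set α} (hs : MonotoneClass A s)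
    (ht : MonotoneClass A t) : MonotoneClass A (s ∩ t) := by
  refine inter_right (fun a ha => ?_) hs
  rw [Set.inter_comm]
  exact inter_right (fun b hb => basic _ (hA.inter_mem hb ha)) ht

theorem union (hA : IsSetAlgebra A) {s t : Set α} (hs : MonotoneClass A s)
    (ht : MonotoneClass A t) : MonotoneClass A (s ∪ t) := by
  have := compl hA (inter hA (compl hA hs) (compl hA ht))
  rwa [← Set.compl_union, compl_compl] at this

/-- The monotone class theorem. -/
theorem of_generateFrom (hA : IsSetAlgebra A) {s : Set α}
    (hs : MeasurableSet[MeasurableSpace.generateFrom A] s) : MonotoneClass A s := by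
  induction hs with
  | basic s hs => exact basic _ hs
  | empty => exact basic _ hA.empty_mem
  | compl s _ ih => exact compl hA ih
  | iUnion f _ ih =>
    -- The class is closed only under monotone unions, so the union is replaced by that of the
    -- partial unions.
    rw [← Set.iUnion_accumulate]
    refine iUnion _ Set.monotone_accumulate fun k => ?_
    induction k with
    | zero => simpa using ih 0
    | succ k ihk =>
      rw [Set.accumulate_succ]
      exact union hA ihk (ih _)

end MonotoneClass

/-! ### S-finiteness of kernels of locally finite measures. -/

/-- A kernel whose measures are finite, without uniform bound, is s-finite. -/
theorem isSFiniteKernel_of_forall_lt_top {α β : Type*} [MeasurableSpace α] [MeasurableSpace β]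
    (κ : Kernel α β) (h : ∀ a, κ a Set.univ < ∞) : IsSFiniteKernel κ := by
  classical
  have hm : ∀ m : ℕ, MeasurableSet {a | ⌊(κ a Set.univ).toReal⌋₊ = m} := fun m =>
    (Nat.measurable_floor.comp
      (κ.measurable_coe MeasurableSet.univ).ennreal_toReal) (measurableSet_singleton m)
  -- The parameter space is cut according to the integer part of the total mass; the `m`-th slice
  -- has masses below `m + 1`.
  let κs : ℕ → Kernel α β := fun m => Kernel.piecewise (hm m) κ 0
  have hsum : κ = Kernel.sum κs := by
    ext a s hs
    rw [Kernel.sum_apply' _ _ hs, tsum_eq_single ⌊(κ a Set.univ).toReal⌋₊]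
    · simp [κs, Kernel.piecewise_apply]
    · intro m hm'
      simp [κs, Kernel.piecewise_apply, hm'.symm]
  have : ∀ m, IsFiniteKernel (κs m) := by
    refine fun m => ⟨⟨m + 1, by finiteness, fun a => ?_⟩⟩
    by_cases ha : ⌊(κ a Set.univ).toReal⌋₊ = m
    · simp only [κs, Kernel.piecewise_apply, Set.mem_ofPred_eq, ha, if_true]
      rw [← ENNReal.ofReal_toReal (h a).ne, ← ha]
      refine (ENNReal.ofReal_le_ofReal (Nat.lt_floor_add_one _).le).trans ?_
      rw [ENNReal.ofReal_add (by positivity) zero_le_one]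
      simp
    · simp [κs, Kernel.piecewise_apply, ha]
  rw [hsum]
  infer_instance

/-- Restriction to each piece gives finite measures, so the previous lemma applies to it. This suits
a random landscape: finitely many buildings per strip, with no bound uniform in `ω`. -/
theorem isSFiniteKernel_of_cover {α β ι : Type*} [MeasurableSpace α] [MeasurableSpace β]
    [Countable ι] (κ : Kernel α β) (s : ι → Set β) (hs : ∀ i, MeasurableSet (s i))
    (hd : Pairwise (Function.onFun Disjoint s)) (hU : ⋃ i, s i = Set.univ)
    (h : ∀ a i, κ a (s i) < ∞) : IsSFiniteKernel κ := by
  have hsum : κ = Kernel.sum fun i => κ.restrict (hs i) := by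
    ext a t ht
    rw [Kernel.sum_apply' _ _ ht]
    simp_rw [Kernel.restrict_apply' _ _ _ ht]
    rw [← measure_iUnion (fun i j hij => (hd hij).mono Set.inter_subset_right
      Set.inter_subset_right) (fun i => ht.inter (hs i)), ← Set.inter_iUnion, hU, Set.inter_univ]
  have : ∀ i, IsSFiniteKernel (κ.restrict (hs i)) := fun i =>
    isSFiniteKernel_of_forall_lt_top _ fun a => by
      rw [Kernel.restrict_apply, Measure.restrict_apply_univ]; exact h a i
  rw [hsum]
  infer_instance

/-! Landscapes as counting measures. -/

theorem IsLandscape.countable {S : Set (ℝ × ℝ)} (hS : IsLandscape S) : S.Countable := by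
  have : S = ⋃ m : ℕ, {q ∈ S | -(m : ℝ) ≤ q.1 ∧ q.1 ≤ m} := by
    ext q
    simp only [Set.mem_iUnion, Set.mem_ofPred_eq, exists_and_left]
    refine ⟨fun hq => ⟨hq, ?_⟩, fun h => h.1⟩
    obtain ⟨m, hm⟩ := exists_nat_ge |q.1|
    exact ⟨m, abs_le.1 hm⟩
  rw [this]
  exact Set.countable_iUnion fun m => (hS.2 _ _).countable

/-- The counting measure of a set of buildings. -/
noncomputable def pointMeasure (S : Set (ℝ × ℝ)) : Measure (ℝ × ℝ) := Measure.count.restrict S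

theorem pointMeasure_apply {S : Set (ℝ × ℝ)} (hS : IsLandscape S) {B : Set (ℝ × ℝ)}
    (hB : MeasurableSet B) : pointMeasure S B = ((S ∩ B).encard : ℝ≥0∞) := by
  rw [pointMeasure, Measure.restrict_apply hB,
    Measure.count_apply (hB.inter hS.countable.measurableSet), Set.inter_comm]

theorem pointMeasure_eq_zero_iff {S : Set (ℝ × ℝ)} (hS : IsLandscape S) {B : Set (ℝ × ℝ)}
    (hB : MeasurableSet B) : pointMeasure S B = 0 ↔ S ∩ B = ∅ := by
  rw [pointMeasure_apply hS hB]
  simp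

/-- The points whose base lies in the cell number `z` of the grid of mesh `1 / (k + 1)`. -/
def gridStrip (k : ℕ) (z : ℤ) : Set (ℝ × ℝ) := {q | ⌊(k + 1 : ℝ) * q.1⌋ = z}

theorem measurableSet_gridStrip (k : ℕ) (z : ℤ) : MeasurableSet (gridStrip k z) :=
  (Int.measurable_floor.comp (measurable_fst.const_mul _)) (measurableSet_singleton z)

theorem disjoint_gridStrip (k : ℕ) {z z' : ℤ} (h : z ≠ z') :
    Disjoint (gridStrip k z) (gridStrip k z') :=
  Set.disjoint_left.2 fun _ h1 h2 => h (h1.symm.trans h2)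

theorem gridStrip_subset (k : ℕ) (z : ℤ) :
    gridStrip k z ⊆ {q | z / (k + 1 : ℝ) ≤ q.1 ∧ q.1 ≤ (z + 1) / (k + 1 : ℝ)} := by
  intro q hq
  have := Int.floor_eq_iff.1 hq
  have hk : (0 : ℝ) < k + 1 := by positivity
  constructor
  · rw [div_le_iff₀ hk]; linarith
  · rw [le_div_iff₀ hk]; linarith

theorem iUnion_gridStrip (k : ℕ) : ⋃ z, gridStrip k z = Set.univ :=
  Set.eq_univ_of_forall fun _ => Set.mem_iUnion.2 ⟨_, rfl⟩

theorem pointMeasure_lt_top {S : Set (ℝ × ℝ)} (hS : IsLandscape S) {B : Set (ℝ × ℝ)}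
    (hB : MeasurableSet B) {a b : ℝ} (h : B ⊆ {q | a ≤ q.1 ∧ q.1 ≤ b}) :
    pointMeasure S B < ∞ := by
  rw [pointMeasure_apply hS hB]
  have : (S ∩ B).Finite := (hS.2 a b).subset fun q hq => ⟨hq.1, h hq.2⟩
  rw [← this.cast_ncard_eq]
  simp

theorem pointMeasure_gridStrip_lt_top {S : Set (ℝ × ℝ)} (hS : IsLandscape S) (k : ℕ) (z : ℤ) :
    pointMeasure S (gridStrip k z) < ∞ :=
  pointMeasure_lt_top hS (measurableSet_gridStrip k z) (gridStrip_subset k z)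

theorem sigmaFinite_of_gridStrip {m : Measure (ℝ × ℝ)} (h : ∀ z, m (gridStrip 0 z) < ∞) :
    SigmaFinite m :=
  ⟨⟨{ set := fun i => gridStrip 0 ((Denumerable.eqv ℤ).symm i)
      set_mem := fun _ => trivial
      finite := fun i => h _
      spanning := by
        rw [← iUnion_gridStrip 0]
        exact (Denumerable.eqv ℤ).symm.surjective.iUnion_comp (gridStrip 0) }⟩⟩

theorem sigmaFinite_pointMeasure {S : Set (ℝ × ℝ)} (hS : IsLandscape S) :
    SigmaFinite (pointMeasure S) :=
  sigmaFinite_of_gridStrip (pointMeasure_gridStrip_lt_top hS 0)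

/-- The random tuples of `n` buildings, as a counting measure. -/
noncomputable def tupleMeasure (S : Set (ℝ × ℝ)) (n : ℕ) : Measure (Fin n → ℝ × ℝ) :=
  Measure.pi fun _ => pointMeasure S

theorem tupleMeasure_compl {S : Set (ℝ × ℝ)} (hS : IsLandscape S) (n : ℕ) :
    tupleMeasure S n {p | ∀ i, p i ∈ S}ᶜ = 0 := by
  have := sigmaFinite_pointMeasure hS
  have h : {p : Fin n → ℝ × ℝ | ∀ i, p i ∈ S}ᶜ = ⋃ i, Function.eval i ⁻¹' Sᶜ := by
    ext p; simp
  rw [h]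
  refine measure_iUnion_null fun i => Measure.pi_eval_preimage_null _ ?_
  rw [pointMeasure_eq_zero_iff hS hS.countable.measurableSet.compl, Set.inter_compl_self]

theorem tupleMeasure_singleton {S : Set (ℝ × ℝ)} (hS : IsLandscape S) {n : ℕ}
    {p : Fin n → ℝ × ℝ} (hp : ∀ i, p i ∈ S) : tupleMeasure S n {p} = 1 := by
  have := sigmaFinite_pointMeasure hS
  rw [tupleMeasure, Measure.pi_singleton]
  refine Finset.prod_eq_one fun i _ => ?_
  rw [pointMeasure_apply hS (measurableSet_singleton _),
    Set.inter_eq_right.2 (Set.singleton_subset_iff.2 (hp i))]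
  simp

open Classical in
/-- The tuple measure of a set that meets the tuples of buildings in at most one point. -/
theorem tupleMeasure_eq_ite {S : Set (ℝ × ℝ)} (hS : IsLandscape S) {n : ℕ}
    {D : Set (Fin n → ℝ × ℝ)}
    (hD : ∀ p ∈ D, ∀ p' ∈ D, (∀ i, p i ∈ S) → (∀ i, p' i ∈ S) → p = p') :
    tupleMeasure S n D = if ∃ p ∈ D, ∀ i, p i ∈ S then 1 else 0 := by
  have h0 : tupleMeasure S n D = tupleMeasure S n (D ∩ {p | ∀ i, p i ∈ S}) := by
    refine le_antisymm ?_ (measure_mono Set.inter_subset_left)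
    rw [← Set.inter_union_compl D {p | ∀ i, p i ∈ S}]
    refine (measure_union_le _ _).trans ?_
    rw [measure_mono_null Set.inter_subset_right (tupleMeasure_compl hS n), add_zero,
      Set.inter_union_compl]
  rw [h0]
  split_ifs with h
  · obtain ⟨p, hp, hpS⟩ := h
    have : D ∩ {p | ∀ i, p i ∈ S} = {p} := by
      ext p'
      exact ⟨fun h' => hD _ h'.1 _ hp h'.2 hpS, fun h' => h' ▸ ⟨hp, hpS⟩⟩
    rw [this, tupleMeasure_singleton hS hpS]
  · have : D ∩ {p | ∀ i, p i ∈ S} = ∅ := by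
      ext p'
      simp only [Set.mem_inter_iff, Set.mem_ofPred_eq, Set.mem_empty_iff_false, iff_false]
      exact fun h' => h ⟨p', h'.1, h'.2⟩
    rw [this, measure_empty]

/-- The random counting measure of a random landscape. -/
noncomputable def pointKernel {Ω : Type*} [MeasurableSpace Ω] (L : Ω → Set (ℝ × ℝ))
    (hL : ∀ ω, IsLandscape (L ω))
    (hm : ∀ B : Set (ℝ × ℝ), MeasurableSet B → Measurable (count L B)) : Kernel Ω (ℝ × ℝ) where
  toFun ω := pointMeasure (L ω)
  measurable' := by
    refine Measure.measurable_of_measurable_coe _ fun B hB => ?_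
    simp_rw [fun ω => pointMeasure_apply (hL ω) hB]
    exact (Measurable.of_discrete (f := fun n : ℕ∞ => (n : ℝ≥0∞))).comp (hm B hB)

section RandomLandscape

variable {Ω : Type*} [MeasurableSpace Ω] {L : Ω → Set (ℝ × ℝ)}

theorem pointKernel_apply (hL : ∀ ω, IsLandscape (L ω))
    (hm : ∀ B : Set (ℝ × ℝ), MeasurableSet B → Measurable (count L B)) (ω : Ω) :
    pointKernel L hL hm ω = pointMeasure (L ω) := rfl

instance (hL : ∀ ω, IsLandscape (L ω))
    (hm : ∀ B : Set (ℝ × ℝ), MeasurableSet B → Measurable (count L B)) :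
    IsSFiniteKernel (pointKernel L hL hm) :=
  isSFiniteKernel_of_cover _ (gridStrip 0) (measurableSet_gridStrip 0)
    (fun _ _ => disjoint_gridStrip 0) (iUnion_gridStrip 0)
    fun ω => pointMeasure_gridStrip_lt_top (hL ω) 0

/-- Peeling off one coordinate identifies the product measure with a product of two kernels, which
gives measurability in `ω` by induction on `n`. -/
theorem exists_tupleKernel (hL : ∀ ω, IsLandscape (L ω))
    (hm : ∀ B : Set (ℝ × ℝ), MeasurableSet B → Measurable (count L B)) (n : ℕ) :
    ∃ κ : Kernel Ω (Fin n → ℝ × ℝ), IsSFiniteKernel κ ∧ ∀ ω, κ ω = tupleMeasure (L ω) n := by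
  induction n with
  | zero =>
    refine ⟨Kernel.const _ (Measure.dirac fun i => i.elim0), inferInstance, fun ω => ?_⟩
    rw [Kernel.const_apply, tupleMeasure, Measure.pi_of_empty _ fun i => i.elim0]
  | succ n ih =>
    obtain ⟨κ, hκ, hκ'⟩ := ih
    refine ⟨(pointKernel L hL hm ×ₖ κ).map
      (MeasurableEquiv.piFinSuccAbove (fun _ => ℝ × ℝ) 0).symm, inferInstance, fun ω => ?_⟩
    have := sigmaFinite_pointMeasure (hL ω)
    rw [Kernel.map_apply _ (MeasurableEquiv.measurable _), Kernel.prod_apply, hκ',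
      pointKernel_apply]
    exact (measurePreserving_piFinSuccAbove (fun _ : Fin (n + 1) => pointMeasure (L ω))
      0).symm.map_eq

/-- The random counting measure of the `n`-tuples of buildings of a random landscape. -/
noncomputable def tupleKernel (hL : ∀ ω, IsLandscape (L ω))
    (hm : ∀ B : Set (ℝ × ℝ), MeasurableSet B → Measurable (count L B)) (n : ℕ) :
    Kernel Ω (Fin n → ℝ × ℝ) :=
  (exists_tupleKernel hL hm n).choose

instance (hL : ∀ ω, IsLandscape (L ω))
    (hm : ∀ B : Set (ℝ × ℝ), MeasurableSet B → Measurable (count L B))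
    (n : ℕ) : IsSFiniteKernel (tupleKernel hL hm n) :=
  (exists_tupleKernel hL hm n).choose_spec.1

theorem tupleKernel_apply (hL : ∀ ω, IsLandscape (L ω))
    (hm : ∀ B : Set (ℝ × ℝ), MeasurableSet B → Measurable (count L B))
    (n : ℕ) (ω : Ω) : tupleKernel hL hm n ω = tupleMeasure (L ω) n :=
  (exists_tupleKernel hL hm n).choose_spec.2 ω

/-- Pulling the point kernel back to `Ω × β` lets the region depend on the parameter in `β`, and the
mass of a measurable section of an s-finite kernel is jointly measurable. -/
theorem measurableSet_void (hL : ∀ ω, IsLandscape (L ω))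
    (hm : ∀ B : Set (ℝ × ℝ), MeasurableSet B → Measurable (count L B))
    {β : Type*} [MeasurableSpace β] {V : Set (β × (ℝ × ℝ))}
    (hV : MeasurableSet V) :
    MeasurableSet {x : Ω × β | pointMeasure (L x.1) (Prod.mk x.2 ⁻¹' V) = 0} := by
  have h : MeasurableSet {y : (Ω × β) × (ℝ × ℝ) | (y.1.2, y.2) ∈ V} :=
    (((measurable_snd.comp measurable_fst).prodMk measurable_snd)) hV
  have := Kernel.measurable_kernel_prodMk_left
    (κ := (pointKernel L hL hm).comap (Prod.fst : Ω × β → Ω) measurable_fst) h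
  exact this (measurableSet_singleton 0)

theorem measurable_tupleMeasure (hL : ∀ ω, IsLandscape (L ω))
    (hm : ∀ B : Set (ℝ × ℝ), MeasurableSet B → Measurable (count L B))
    {β : Type*} [MeasurableSpace β] {n : ℕ}
    {D : Set ((Ω × β) × (Fin n → ℝ × ℝ))} (hD : MeasurableSet D) :
    Measurable fun x : Ω × β => tupleMeasure (L x.1) n (Prod.mk x ⁻¹' D) := by
  have := Kernel.measurable_kernel_prodMk_left
    (κ := (tupleKernel hL hm n).comap (Prod.fst : Ω × β → Ω) measurable_fst) hD
  simpa only [Kernel.comap_apply, tupleKernel_apply] using this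

end RandomLandscape

/-! ### Mean counts and void probabilities of the Poisson building process. -/

section

variable {Ω : Type*} [MeasurableSpace Ω] {P : Measure Ω}
  {lam : ℝ} {ν : Measure ℝ} {L : Ω → Set (ℝ × ℝ)}

theorem volume_prod_lt_top [IsProbabilityMeasure ν] {B : Set (ℝ × ℝ)} {a b : ℝ}
    (h : B ⊆ {q | a ≤ q.1 ∧ q.1 ≤ b}) : ((volume : Measure ℝ).prod ν) B < ∞ := by
  have h2 : {q : ℝ × ℝ | a ≤ q.1 ∧ q.1 ≤ b} = Set.Icc a b ×ˢ Set.univ := by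
    ext q; simp
  refine (measure_mono h).trans_lt ?_
  rw [h2, Measure.prod_prod]
  simp

theorem tsum_nat_mul_poisson (m : ℝ) (hm : 0 ≤ m) :
    ∑' k : ℕ, (k : ℝ≥0∞) * ENNReal.ofReal (Real.exp (-m) * m ^ k / (k.factorial : ℝ))
      = ENNReal.ofReal m := by
  rw [tsum_eq_zero_add' ENNReal.summable]
  have h : ∀ k : ℕ, ((k + 1 : ℕ) : ℝ≥0∞)
      * ENNReal.ofReal (Real.exp (-m) * m ^ (k + 1) / ((k + 1).factorial : ℝ))
      = ENNReal.ofReal m * ENNReal.ofReal (Real.exp (-m) * m ^ k / (k.factorial : ℝ)) := by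
    intro k
    rw [← ENNReal.ofReal_natCast, ← ENNReal.ofReal_mul (by positivity), ← ENNReal.ofReal_mul hm]
    congr 1
    rw [Nat.factorial_succ]
    push_cast
    have : (k.factorial : ℝ) ≠ 0 := by positivity
    field_simp
    ring
  simp_rw [h]
  have h1 : HasSum (fun k : ℕ => Real.exp (-m) * m ^ k / (k.factorial : ℝ)) 1 :=
    hasSum_one_poissonMeasure ⟨m, hm⟩
  rw [ENNReal.tsum_mul_left, ← ENNReal.ofReal_tsum_of_nonneg (fun k => by positivity) h1.summable]
  rw [h1.tsum_eq]
  simp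

namespace IsPoissonBuildingProcess

theorem measurable_pointMeasure (hL : IsPoissonBuildingProcess lam ν P L) {A : Set (ℝ × ℝ)}
    (hA : MeasurableSet A) : Measurable fun ω => pointMeasure (L ω) A :=
  (pointKernel L hL.landscape hL.measurable_count).measurable_coe hA

/-- The strip makes the count finite, so it is the sum of its values weighted by the indicators of
its level sets, and the mean of the Poisson law finishes the computation. -/
theorem lintegral_pointMeasure [IsProbabilityMeasure ν]
    (hL : IsPoissonBuildingProcess lam ν P L) (hlam : 0 ≤ lam)
    {A : Set (ℝ × ℝ)} (hA : MeasurableSet A) {a b : ℝ} (h : A ⊆ {q | a ≤ q.1 ∧ q.1 ≤ b}) :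
    ∫⁻ ω, pointMeasure (L ω) A ∂P
      = ENNReal.ofReal lam * ((volume : Measure ℝ).prod ν) A := by
  have hμ : ((volume : Measure ℝ).prod ν) A ≠ ∞ := (volume_prod_lt_top h).ne
  have hms : ∀ k : ℕ, MeasurableSet {ω | count L A ω = k} := fun k =>
    hL.measurable_count A hA (MeasurableSet.of_discrete (s := {(k : ℕ∞)}))
  have hpt : ∀ ω, pointMeasure (L ω) A
      = ∑' k : ℕ, {ω | count L A ω = k}.indicator (fun _ => (k : ℝ≥0∞)) ω := by
    intro ω
    have hfin : (L ω ∩ A).Finite :=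
      ((hL.landscape ω).2 a b).subset fun q hq => ⟨hq.1, h hq.2⟩
    rw [pointMeasure_apply (hL.landscape ω) hA, tsum_eq_single (L ω ∩ A).ncard]
    · rw [Set.indicator_of_mem]
      · rw [← hfin.cast_ncard_eq]; simp
      · exact hfin.cast_ncard_eq.symm
    · intro k hk
      refine Set.indicator_of_notMem (fun h' => hk ?_) _
      have h'' : (L ω ∩ A).encard = k := h'
      rw [← hfin.cast_ncard_eq] at h''
      exact_mod_cast h''.symm
  simp_rw [hpt]
  rw [lintegral_tsum fun k => (measurable_const.indicator (hms k)).aemeasurable]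
  simp_rw [lintegral_indicator_const (hms _), hL.poisson A hA hμ]
  rw [tsum_nat_mul_poisson _ (by positivity), ENNReal.ofReal_mul hlam, ENNReal.ofReal_toReal hμ]

theorem measure_void (hL : IsPoissonBuildingProcess lam ν P L) {B : Set (ℝ × ℝ)}
    (hB : MeasurableSet B) (hμ : ((volume : Measure ℝ).prod ν) B ≠ ∞) :
    P {ω | count L B ω = 0}
      = ENNReal.ofReal (Real.exp (-(lam * (((volume : Measure ℝ).prod ν) B).toReal))) := by
  have := hL.poisson B hB hμ 0
  simpa using this

/-- When `B` is void, `A i` may be replaced by `A i \ B` without changing the counts. The sets `B`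
and `A i \ B` are pairwise disjoint, so the expectation of the product factors. -/
theorem lintegral_prod_void [IsProbabilityMeasure ν]
    (hL : IsPoissonBuildingProcess lam ν P L) (hlam : 0 ≤ lam)
    {n : ℕ} {A : Fin n → Set (ℝ × ℝ)} (hA : ∀ i, MeasurableSet (A i))
    (hd : Pairwise (Function.onFun Disjoint A)) {a b : Fin n → ℝ}
    (hab : ∀ i, A i ⊆ {q | a i ≤ q.1 ∧ q.1 ≤ b i})
    {B : Set (ℝ × ℝ)} (hB : MeasurableSet B) (hμ : ((volume : Measure ℝ).prod ν) B ≠ ∞) :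
    ∫⁻ ω in {ω | pointMeasure (L ω) B = 0}, ∏ i, pointMeasure (L ω) (A i) ∂P
      = ENNReal.ofReal lam ^ n
        * (ENNReal.ofReal (Real.exp (-(lam * (((volume : Measure ℝ).prod ν) B).toReal)))
          * ∏ i, ((volume : Measure ℝ).prod ν) (A i \ B)) := by
  -- Slot `0` carries the void set, read through the indicator of a zero count; the other slots
  -- carry the counts themselves.
  let C : Fin (n + 1) → Set (ℝ × ℝ) := Fin.cons B fun i => A i \ B
  let g : Fin (n + 1) → ℕ∞ → ℝ≥0∞ := Fin.cons (fun c => if c = 0 then 1 else 0) fun _ c => c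
  have hC : ∀ i, MeasurableSet (C i) := by
    refine Fin.cases hB fun i => ?_
    simpa [C] using (hA i).diff hB
  have hCd : Pairwise (Function.onFun Disjoint C) := by
    intro i j
    refine Fin.cases ?_ (fun i => ?_) i <;> refine Fin.cases ?_ (fun j => ?_) j
    · exact fun h => absurd rfl h
    · intro _
      simpa [C, Function.onFun] using Set.disjoint_sdiff_right
    · intro _
      simpa [C, Function.onFun] using Set.disjoint_sdiff_left
    · intro hij
      have : i ≠ j := fun h => hij (by rw [h])
      simpa [C, Function.onFun] using
        (hd this).mono Set.sdiff_subset Set.sdiff_subset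
  have hind := (hL.indep (n + 1) C hC hCd).comp g fun i => Measurable.of_discrete
  have hint := lintegral_prod_eq_prod_lintegral_of_indepFun Finset.univ
    (fun i => g i ∘ count L (C i)) hind
    fun i => Measurable.of_discrete.comp (hL.measurable_count _ (hC i))
  have hms : MeasurableSet {ω | count L B ω = 0} :=
    hL.measurable_count B hB (MeasurableSet.of_discrete (s := {0}))
  have hset : {ω | pointMeasure (L ω) B = 0} = {ω | count L B ω = 0} := by
    ext ω
    simp only [Set.mem_ofPred_eq, pointMeasure_apply (hL.landscape ω) hB, count]
    simp
  have hpt : ∀ ω, {ω | count L B ω = 0}.indicator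
      (fun ω => ∏ i, pointMeasure (L ω) (A i)) ω
      = ∏ i, (g i ∘ count L (C i)) ω := by
    intro ω
    rw [Fin.prod_univ_succ]
    by_cases h : count L B ω = 0
    · rw [Set.indicator_of_mem (by exact h)]
      have h0 : pointMeasure (L ω) B = 0 := by
        have : ω ∈ {ω | count L B ω = 0} := h
        rwa [← hset] at this
      simp only [g, C, Fin.cons_zero, Function.comp, h, if_true, one_mul, Fin.cons_succ]
      refine Finset.prod_congr rfl fun i _ => ?_
      rw [← measure_sdiff_null h0, pointMeasure_apply (hL.landscape ω) ((hA i).diff hB)]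
      rfl
    · rw [Set.indicator_of_notMem (by exact h)]
      simp [g, C, h]
  rw [hset, ← lintegral_indicator hms]
  simp_rw [hpt]
  rw [hint, Fin.prod_univ_succ]
  have h0 : ∫⁻ ω, (g 0 ∘ count L (C 0)) ω ∂P = P {ω | count L B ω = 0} := by
    have : g 0 ∘ count L (C 0) = {ω | count L B ω = 0}.indicator fun _ => 1 := by
      ext ω
      by_cases h : count L B ω = 0 <;> simp [g, C, h]
    rw [this, lintegral_indicator_const hms, one_mul]
  have h1 : ∀ i : Fin n, ∫⁻ ω, (g i.succ ∘ count L (C i.succ)) ω ∂P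
      = ENNReal.ofReal lam * ((volume : Measure ℝ).prod ν) (A i \ B) := by
    intro i
    rw [← hL.lintegral_pointMeasure hlam ((hA i).diff hB) (Set.sdiff_subset.trans (hab i))]
    refine lintegral_congr fun ω => ?_
    rw [pointMeasure_apply (hL.landscape ω) ((hA i).diff hB)]
    simp [g, C, count]
  rw [h0, hL.measure_void hB hμ]
  simp_rw [h1]
  rw [Finset.prod_mul_distrib, Finset.prod_const, Finset.card_univ, Fintype.card_fin]
  ring

end IsPoissonBuildingProcess

end

/-! ### The Mecke formula for void regions: regions that do not depend on the tuple. -/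

open Filter Topology

/-- The intensity measure of the building process of rate one. -/
notation "𝔪(" ν ")" => Measure.prod (volume : Measure ℝ) ν

/-- The probability that a Poisson building process has no building in `B`. -/
noncomputable def voidProb (lam : ℝ) (ν : Measure ℝ) (B : Set (ℝ × ℝ)) : ℝ≥0∞ :=
  ENNReal.ofReal (Real.exp (-(lam * (𝔪(ν) B).toReal)))

theorem voidProb_le_one {lam : ℝ} (hlam : 0 ≤ lam) (ν : Measure ℝ) (B : Set (ℝ × ℝ)) :
    voidProb lam ν B ≤ 1 := by
  rw [voidProb, ← ENNReal.ofReal_one]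
  refine ENNReal.ofReal_le_ofReal (Real.exp_le_one_iff.2 ?_)
  have := mul_nonneg hlam (ENNReal.toReal_nonneg (a := 𝔪(ν) B))
  linarith

theorem tendsto_voidProb (lam : ℝ) {ν : Measure ℝ} {B : ℕ → Set (ℝ × ℝ)} {C : Set (ℝ × ℝ)}
    (hC : 𝔪(ν) C ≠ ∞) (h : Tendsto (fun k => 𝔪(ν) (B k)) atTop (𝓝 (𝔪(ν) C))) :
    Tendsto (fun k => voidProb lam ν (B k)) atTop (𝓝 (voidProb lam ν C)) :=
  (ENNReal.continuous_ofReal.tendsto _).comp <| (Real.continuous_exp.tendsto _).comp <|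
    (((ENNReal.tendsto_toReal hC).comp h).const_mul lam).neg

section

variable {n : ℕ}

/-- The tuples that avoid the regions attached to them. -/
def avoiding (V : Set ((Fin n → ℝ × ℝ) × (ℝ × ℝ))) : Set (Fin n → ℝ × ℝ) :=
  {p | ∀ i, (p, p i) ∉ V}

theorem measurableSet_avoiding {V : Set ((Fin n → ℝ × ℝ) × (ℝ × ℝ))} (hV : MeasurableSet V) :
    MeasurableSet (avoiding V) := by
  have : avoiding V = ⋂ i, (fun p : Fin n → ℝ × ℝ => (p, p i)) ⁻¹' Vᶜ := by
    ext p; simp [avoiding]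
  rw [this]
  exact MeasurableSet.iInter fun i =>
    (measurable_id.prodMk (measurable_pi_apply i)) hV.compl

theorem measurable_voidProb {β : Type*} [MeasurableSpace β] (lam : ℝ) (ν : Measure ℝ) [SFinite ν]
    {V : Set (β × (ℝ × ℝ))} (hV : MeasurableSet V) :
    Measurable fun p => voidProb lam ν (Prod.mk p ⁻¹' V) :=
  ENNReal.measurable_ofReal.comp <| Real.measurable_exp.comp <|
    ((measurable_measure_prodMk_left hV).ennreal_toReal.const_mul lam).neg

variable {Ω : Type*} [MeasurableSpace Ω] {P : Measure Ω}
  {lam : ℝ} {ν : Measure ℝ} {L : Ω → Set (ℝ × ℝ)}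

/-- The mean number of tuples of buildings whose attached region is void, as a measure. -/
noncomputable def voidTuples (P : Measure Ω) (hL : IsPoissonBuildingProcess lam ν P L)
    (V : Set ((Fin n → ℝ × ℝ) × (ℝ × ℝ))) : Measure (Fin n → ℝ × ℝ) :=
  ((P ⊗ₘ tupleKernel hL.landscape hL.measurable_count n).restrict
    {x | pointMeasure (L x.1) (Prod.mk x.2 ⁻¹' V) = 0}).map Prod.snd

/-- The measure that the Mecke formula equates with `voidTuples`. -/
noncomputable def voidIntensity (lam : ℝ) (ν : Measure ℝ)
    (V : Set ((Fin n → ℝ × ℝ) × (ℝ × ℝ))) : Measure (Fin n → ℝ × ℝ) :=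
  (ENNReal.ofReal lam ^ n) • ((Measure.pi fun _ => 𝔪(ν)).restrict (avoiding V)).withDensity
    fun p => voidProb lam ν (Prod.mk p ⁻¹' V)

theorem voidTuples_apply [SFinite P] (hL : IsPoissonBuildingProcess lam ν P L)
    {V : Set ((Fin n → ℝ × ℝ) × (ℝ × ℝ))} (hV : MeasurableSet V) {D : Set (Fin n → ℝ × ℝ)}
    (hD : MeasurableSet D) :
    voidTuples P hL V D = ∫⁻ ω, tupleMeasure (L ω) n
      {p | p ∈ D ∧ pointMeasure (L ω) (Prod.mk p ⁻¹' V) = 0} ∂P := by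
  have hs := measurableSet_void hL.landscape hL.measurable_count hV
  rw [voidTuples, Measure.map_apply measurable_snd hD,
    Measure.restrict_apply (measurable_snd hD),
    Measure.compProd_apply ((measurable_snd hD).inter hs)]
  simp_rw [tupleKernel_apply]
  rfl

theorem voidIntensity_apply {V : Set ((Fin n → ℝ × ℝ) × (ℝ × ℝ))}
    {D : Set (Fin n → ℝ × ℝ)} (hD : MeasurableSet D) :
    voidIntensity lam ν V D = ENNReal.ofReal lam ^ n *
      ∫⁻ p in D ∩ avoiding V, voidProb lam ν (Prod.mk p ⁻¹' V) ∂(Measure.pi fun _ => 𝔪(ν)) := by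
  rw [voidIntensity, Measure.smul_apply, withDensity_apply _ hD, Measure.restrict_restrict hD,
    smul_eq_mul]

/-- The tuples whose bases lie in given cells of a grid. -/
def gridBox (k : ℕ) (z : Fin n → ℤ) : Set (Fin n → ℝ × ℝ) := {p | ∀ i, p i ∈ gridStrip k (z i)}

theorem gridBox_eq (k : ℕ) (z : Fin n → ℤ) :
    gridBox k z = Set.pi Set.univ fun i => gridStrip k (z i) := by
  ext p; simp [gridBox]

theorem measurableSet_gridBox (k : ℕ) (z : Fin n → ℤ) : MeasurableSet (gridBox k z) := by
  rw [gridBox_eq]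
  exact MeasurableSet.univ_pi fun i => measurableSet_gridStrip k (z i)

/-- Distinct strips make the factors of the box disjoint, so this is `lintegral_prod_void`: the
tuple measure of a box is the product of the counts, and avoiding `B` turns each factor into `A i \
B`. -/
theorem voidTuples_const_pi [IsProbabilityMeasure P] [IsProbabilityMeasure ν]
    (hL : IsPoissonBuildingProcess lam ν P L) (hlam : 0 ≤ lam) {B : Set (ℝ × ℝ)}
    (hB : MeasurableSet B) (hμ : 𝔪(ν) B ≠ ∞) {k : ℕ} {z : Fin n → ℤ}
    (hz : Function.Injective z) {A : Fin n → Set (ℝ × ℝ)} (hA : ∀ i, MeasurableSet (A i)) :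
    voidTuples P hL {x | x.2 ∈ B} (Set.pi Set.univ A ∩ gridBox k z)
      = voidIntensity lam ν {x | x.2 ∈ B} (Set.pi Set.univ A ∩ gridBox k z) := by
  have hA' : ∀ i, MeasurableSet (A i ∩ gridStrip k (z i)) := fun i =>
    (hA i).inter (measurableSet_gridStrip k (z i))
  have hset : MeasurableSet (Set.pi Set.univ A ∩ gridBox k z) :=
    (MeasurableSet.univ_pi hA).inter (measurableSet_gridBox k z)
  have hrect : Set.pi Set.univ A ∩ gridBox k z
      = Set.pi Set.univ fun i => A i ∩ gridStrip k (z i) := by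
    rw [gridBox_eq, ← Set.pi_inter_distrib]
  have hmB : MeasurableSet {ω | pointMeasure (L ω) B = 0} :=
    hL.measurable_pointMeasure hB (measurableSet_singleton 0)
  have hprod := hL.lintegral_prod_void hlam hA' (fun i j hij =>
    (disjoint_gridStrip k (hz.ne hij)).mono Set.inter_subset_right Set.inter_subset_right)
    (fun i => Set.inter_subset_right.trans (gridStrip_subset k (z i))) hB hμ
  have hV : MeasurableSet {x : (Fin n → ℝ × ℝ) × (ℝ × ℝ) | x.2 ∈ B} := measurable_snd hB
  rw [voidTuples_apply hL hV hset, voidIntensity_apply hset]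
  have hl : ∀ ω, tupleMeasure (L ω) n {p | p ∈ Set.pi Set.univ A ∩ gridBox k z ∧
      pointMeasure (L ω) (Prod.mk p ⁻¹' {x | x.2 ∈ B}) = 0}
      = {ω | pointMeasure (L ω) B = 0}.indicator
        (fun ω => ∏ i, pointMeasure (L ω) (A i ∩ gridStrip k (z i))) ω := by
    intro ω
    have := sigmaFinite_pointMeasure (hL.landscape ω)
    have hpre : ∀ p : Fin n → ℝ × ℝ, Prod.mk p ⁻¹' {x : _ × (ℝ × ℝ) | x.2 ∈ B} = B :=
      fun p => rfl
    simp only [hpre]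
    by_cases h : pointMeasure (L ω) B = 0
    · rw [Set.indicator_of_mem (by exact h)]
      simp only [h, and_true, Set.ofPred_mem_eq]
      rw [hrect, tupleMeasure, Measure.pi_pi]
    · rw [Set.indicator_of_notMem (by exact h)]
      simp [h]
  simp_rw [hl]
  rw [lintegral_indicator hmB, hprod]
  congr 1
  have havoid : Set.pi Set.univ A ∩ gridBox k z ∩ avoiding {x | x.2 ∈ B}
      = Set.pi Set.univ fun i => (A i ∩ gridStrip k (z i)) \ B := by
    ext p
    rw [hrect]
    simp only [avoiding, Set.mem_inter_iff, Set.mem_univ_pi, Set.mem_ofPred_eq, Set.mem_sdiff]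
    exact ⟨fun h i => ⟨h.1 i, h.2 i⟩, fun h => ⟨fun i => (h i).1, fun i => (h i).2⟩⟩
  have hconst : ∀ p : Fin n → ℝ × ℝ, voidProb lam ν (Prod.mk p ⁻¹' {x | x.2 ∈ B})
      = voidProb lam ν B := fun p => rfl
  simp_rw [hconst]
  rw [setLIntegral_const, havoid, Measure.pi_pi, voidProb]

theorem voidIntensity_gridBox_lt_top [IsProbabilityMeasure ν] (hlam : 0 ≤ lam) (k : ℕ)
    (z : Fin n → ℤ) (V : Set ((Fin n → ℝ × ℝ) × (ℝ × ℝ))) :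
    voidIntensity lam ν V (gridBox k z) < ∞ := by
  rw [voidIntensity_apply (measurableSet_gridBox k z)]
  refine ENNReal.mul_lt_top (by finiteness) ?_
  refine (lintegral_mono fun p => voidProb_le_one hlam ν _).trans_lt ?_
  rw [lintegral_const, one_mul, Measure.restrict_apply_univ]
  refine (measure_mono Set.inter_subset_left).trans_lt ?_
  rw [gridBox_eq, Measure.pi_pi]
  exact ENNReal.prod_lt_top fun i _ => volume_prod_lt_top (gridStrip_subset k (z i))

/-- Boxes form a π-system that generates the product σ-algebra, and both measures are finite on a
grid box, so agreement on boxes is enough. -/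
theorem voidTuples_const [IsProbabilityMeasure P] [IsProbabilityMeasure ν]
    (hL : IsPoissonBuildingProcess lam ν P L) (hlam : 0 ≤ lam) {B : Set (ℝ × ℝ)}
    (hB : MeasurableSet B) (hμ : 𝔪(ν) B ≠ ∞) {k : ℕ} {z : Fin n → ℤ}
    (hz : Function.Injective z) :
    (voidTuples P hL {x | x.2 ∈ B}).restrict (gridBox k z)
      = (voidIntensity lam ν {x | x.2 ∈ B}).restrict (gridBox k z) := by
  have h : ∀ A : Fin n → Set (ℝ × ℝ), (∀ i, MeasurableSet (A i)) →
      (voidTuples P hL {x | x.2 ∈ B}).restrict (gridBox k z) (Set.pi Set.univ A)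
      = (voidIntensity lam ν {x | x.2 ∈ B}).restrict (gridBox k z) (Set.pi Set.univ A) := by
    intro A hA
    rw [Measure.restrict_apply (MeasurableSet.univ_pi hA),
      Measure.restrict_apply (MeasurableSet.univ_pi hA),
      voidTuples_const_pi hL hlam hB hμ hz hA]
  have huniv := h (fun _ => Set.univ) fun _ => MeasurableSet.univ
  rw [Set.pi_univ] at huniv
  have : IsFiniteMeasure ((voidTuples P hL {x | x.2 ∈ B}).restrict (gridBox k z)) := by
    refine ⟨?_⟩
    rw [huniv, Measure.restrict_apply_univ]
    exact voidIntensity_gridBox_lt_top hlam k z _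
  refine ext_of_generate_finite _ generateFrom_pi.symm isPiSystem_pi ?_ huniv
  rintro _ ⟨A, hA, rfl⟩
  exact h A fun i => hA i (Set.mem_univ i)

end

/-! ### The Mecke formula: from simple regions to measurable ones. -/

section

variable {n : ℕ}

/-- The regions that depend on the tuple through a countably valued function only. -/
def simpleRegions (n : ℕ) : Set (Set ((Fin n → ℝ × ℝ) × (ℝ × ℝ))) :=
  {V | ∃ (c : (Fin n → ℝ × ℝ) → ℕ) (B : ℕ → Set (ℝ × ℝ)), Measurable c ∧
    (∀ m, MeasurableSet (B m)) ∧ V = {x | x.2 ∈ B (c x.1)}}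

/-- For unions, the two countable labels are merged into one by `Nat.pair`. -/
theorem isSetAlgebra_simpleRegions : IsSetAlgebra (simpleRegions n) where
  empty_mem := ⟨fun _ => 0, fun _ => ∅, measurable_const, fun _ => MeasurableSet.empty, rfl⟩
  compl_mem := by
    rintro _ ⟨c, B, hc, hB, rfl⟩
    exact ⟨c, fun m => (B m)ᶜ, hc, fun m => (hB m).compl, rfl⟩
  union_mem := by
    rintro _ _ ⟨c, B, hc, hB, rfl⟩ ⟨c', B', hc', hB', rfl⟩
    refine ⟨fun p => Nat.pair (c p) (c' p), fun m => B m.unpair.1 ∪ B' m.unpair.2,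
      (measurable_of_countable fun x : ℕ × ℕ => Nat.pair x.1 x.2).comp (hc.prodMk hc'),
      fun m => (hB _).union (hB' _), ?_⟩
    ext x
    simp

theorem measurableSet_of_mem_simpleRegions {V : Set ((Fin n → ℝ × ℝ) × (ℝ × ℝ))}
    (hV : V ∈ simpleRegions n) : MeasurableSet V := by
  obtain ⟨c, B, hc, hB, rfl⟩ := hV
  have : {x : (Fin n → ℝ × ℝ) × (ℝ × ℝ) | x.2 ∈ B (c x.1)} = ⋃ m, (c ⁻¹' {m}) ×ˢ B m := by
    ext x; simp
  rw [this]
  exact MeasurableSet.iUnion fun m => (hc (measurableSet_singleton m)).prod (hB m)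

theorem measurableSet_generateFrom_simpleRegions {V : Set ((Fin n → ℝ × ℝ) × (ℝ × ℝ))}
    (hV : MeasurableSet V) : MeasurableSet[MeasurableSpace.generateFrom (simpleRegions n)] V := by
  classical
  rw [← generateFrom_prod] at hV
  refine MeasurableSpace.generateFrom_mono ?_ V hV
  rintro _ ⟨C, hC, B, hB, rfl⟩
  refine ⟨fun p => if p ∈ C then 1 else 0, fun m => if m = 1 then B else ∅,
    Measurable.ite hC measurable_const measurable_const, fun m => ?_, ?_⟩
  · dsimp only
    split_ifs
    exacts [hB, MeasurableSet.empty]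
  · ext x
    by_cases hx : x.1 ∈ C <;> simp [hx]

variable {Ω : Type*} [MeasurableSpace Ω] {P : Measure Ω}
  {lam : ℝ} {ν : Measure ℝ} {L : Ω → Set (ℝ × ℝ)}

theorem voidTuples_apply_congr [SFinite P] (hL : IsPoissonBuildingProcess lam ν P L)
    {V V' : Set ((Fin n → ℝ × ℝ) × (ℝ × ℝ))} (hV : MeasurableSet V) (hV' : MeasurableSet V')
    {D : Set (Fin n → ℝ × ℝ)} (hD : MeasurableSet D)
    (h : ∀ p ∈ D, Prod.mk p ⁻¹' V = Prod.mk p ⁻¹' V') :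
    voidTuples P hL V D = voidTuples P hL V' D := by
  rw [voidTuples_apply hL hV hD, voidTuples_apply hL hV' hD]
  refine lintegral_congr fun ω => congrArg _ ?_
  ext p
  exact and_congr_right fun hp => by rw [h p hp]

theorem voidIntensity_apply_congr {V V' : Set ((Fin n → ℝ × ℝ) × (ℝ × ℝ))}
    (hV : MeasurableSet V)
    {D : Set (Fin n → ℝ × ℝ)} (hD : MeasurableSet D)
    (h : ∀ p ∈ D, Prod.mk p ⁻¹' V = Prod.mk p ⁻¹' V') :
    voidIntensity lam ν V D = voidIntensity lam ν V' D := by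
  rw [voidIntensity_apply hD, voidIntensity_apply hD]
  have hset : D ∩ avoiding V = D ∩ avoiding V' := by
    ext p
    refine and_congr_right fun hp => forall_congr' fun i => not_congr ?_
    change p i ∈ Prod.mk p ⁻¹' V ↔ p i ∈ Prod.mk p ⁻¹' V'
    rw [h p hp]
  rw [← hset]
  congr 1
  exact setLIntegral_congr_fun (hD.inter (measurableSet_avoiding hV)) fun p hp => by
    rw [h p hp.1]

/-- The region `{x | a ≤ x ≤ b}` in every fibre. -/
def slab (n : ℕ) (a : ℝ) : Set ((Fin n → ℝ × ℝ) × (ℝ × ℝ)) := {x | -a ≤ x.2.1 ∧ x.2.1 ≤ a}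

theorem measurableSet_slab (a : ℝ) : MeasurableSet (slab n a) :=
  (measurableSet_le measurable_const (measurable_fst.comp measurable_snd)).inter
    (measurableSet_le (measurable_fst.comp measurable_snd) measurable_const)

/-- The tuples split into the countably many level sets of `c`; on each of them the region is
constant and `voidTuples_const` applies. The slab makes the intensity of the region finite. -/
theorem voidTuples_simple [IsProbabilityMeasure P] [IsProbabilityMeasure ν]
    (hL : IsPoissonBuildingProcess lam ν P L) (hlam : 0 ≤ lam)
    {V : Set ((Fin n → ℝ × ℝ) × (ℝ × ℝ))} (hV : V ∈ simpleRegions n) (a : ℝ) {k : ℕ}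
    {z : Fin n → ℤ} (hz : Function.Injective z) :
    (voidTuples P hL (V ∩ slab n a)).restrict (gridBox k z)
      = (voidIntensity lam ν (V ∩ slab n a)).restrict (gridBox k z) := by
  have hVm := (measurableSet_of_mem_simpleRegions hV).inter (measurableSet_slab a)
  obtain ⟨c, B, hc, hB, rfl⟩ := hV
  have hU : ⋃ m, c ⁻¹' {m} = Set.univ := by ext; simp
  have hcm : ∀ m, MeasurableSet (c ⁻¹' {m}) := fun m => hc (measurableSet_singleton m)
  rw [← Measure.restrict_univ (μ := (voidTuples P hL _).restrict _),
    ← Measure.restrict_univ (μ := (voidIntensity lam ν _).restrict _), ← hU,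
    Measure.restrict_iUnion_congr]
  intro m
  ext D hD
  have hE := (hD.inter (hcm m)).inter (measurableSet_gridBox k z)
  rw [Measure.restrict_apply hD, Measure.restrict_apply (hD.inter (hcm m)),
    Measure.restrict_apply hD, Measure.restrict_apply (hD.inter (hcm m))]
  have hBm : MeasurableSet (B m ∩ {q | -a ≤ q.1 ∧ q.1 ≤ a}) :=
    (hB m).inter ((measurableSet_le measurable_const measurable_fst).inter
      (measurableSet_le measurable_fst measurable_const))
  have hBV : MeasurableSet {x : (Fin n → ℝ × ℝ) × (ℝ × ℝ) |
      x.2 ∈ B m ∩ {q | -a ≤ q.1 ∧ q.1 ≤ a}} := measurable_snd hBm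
  have hsec : ∀ p ∈ D ∩ c ⁻¹' {m} ∩ gridBox k z,
      Prod.mk p ⁻¹' ({x | x.2 ∈ B (c x.1)} ∩ slab n a)
        = Prod.mk p ⁻¹' {x | x.2 ∈ B m ∩ {q | -a ≤ q.1 ∧ q.1 ≤ a}} := by
    rintro p ⟨⟨_, hp⟩, _⟩
    have hp' : c p = m := hp
    ext q
    simp only [slab, hp', Set.mem_preimage, Set.mem_inter_iff, Set.mem_ofPred_eq]
  rw [voidTuples_apply_congr hL hVm hBV hE hsec, voidIntensity_apply_congr hVm hE hsec]
  have := congrArg (fun κ => κ (D ∩ c ⁻¹' {m})) (voidTuples_const hL hlam hBm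
    (volume_prod_lt_top (ν := ν) Set.inter_subset_right).ne (k := k) hz)
  rwa [Measure.restrict_apply (hD.inter (hcm m)),
    Measure.restrict_apply (hD.inter (hcm m))] at this

theorem voidTuples_eq_measure (hL : IsPoissonBuildingProcess lam ν P L)
    {V : Set ((Fin n → ℝ × ℝ) × (ℝ × ℝ))} {D : Set (Fin n → ℝ × ℝ)}
    (hD : MeasurableSet D) :
    voidTuples P hL V D = (P ⊗ₘ tupleKernel hL.landscape hL.measurable_count n)
      {x | x.2 ∈ D ∧ pointMeasure (L x.1) (Prod.mk x.2 ⁻¹' V) = 0} := by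
  rw [voidTuples, Measure.map_apply measurable_snd hD, Measure.restrict_apply (measurable_snd hD)]
  rfl

/-- Dominated convergence: the bound is the indicator of `D`, which has finite measure inside a grid
box. For a given tuple, avoiding `V m` is a condition on `n` points only, so it is eventually
equivalent to avoiding `W`. -/
theorem tendsto_voidIntensity [IsProbabilityMeasure ν] (hlam : 0 ≤ lam)
    {V : ℕ → Set ((Fin n → ℝ × ℝ) × (ℝ × ℝ))} {W : Set ((Fin n → ℝ × ℝ) × (ℝ × ℝ))}
    (hV : ∀ m, MeasurableSet (V m)) (hW : MeasurableSet W) {D : Set (Fin n → ℝ × ℝ)}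
    (hD : MeasurableSet D) {k : ℕ} {z : Fin n → ℤ} (hDz : D ⊆ gridBox k z)
    (hlim : ∀ x, ∀ᶠ m in atTop, x ∈ V m ↔ x ∈ W)
    (hμ : ∀ p ∈ D, 𝔪(ν) (Prod.mk p ⁻¹' W) ≠ ∞ ∧
      Tendsto (fun m => 𝔪(ν) (Prod.mk p ⁻¹' V m)) atTop (𝓝 (𝔪(ν) (Prod.mk p ⁻¹' W)))) :
    Tendsto (fun m => voidIntensity lam ν (V m) D) atTop (𝓝 (voidIntensity lam ν W D)) := by
  have hint : ∀ U, MeasurableSet U → voidIntensity lam ν U D = ENNReal.ofReal lam ^ n *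
      ∫⁻ p, (D ∩ avoiding U).indicator (fun p => voidProb lam ν (Prod.mk p ⁻¹' U)) p
        ∂(Measure.pi fun _ => 𝔪(ν)) := fun U hU => by
    rw [voidIntensity_apply hD, lintegral_indicator (hD.inter (measurableSet_avoiding hU))]
  rw [hint W hW]
  simp_rw [fun m => hint (V m) (hV m)]
  refine ENNReal.Tendsto.const_mul ?_ (Or.inr (by finiteness))
  refine tendsto_lintegral_of_dominated_convergence (D.indicator fun _ => 1) (fun m =>
    (measurable_voidProb lam ν (hV m)).indicator (hD.inter (measurableSet_avoiding (hV m))))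
    (fun m => Eventually.of_forall fun p => ?_) ?_ (Eventually.of_forall fun p => ?_)
  · by_cases hp : p ∈ D ∩ avoiding (V m)
    · rw [Set.indicator_of_mem hp, Set.indicator_of_mem hp.1]
      exact voidProb_le_one hlam ν _
    · rw [Set.indicator_of_notMem hp]
      exact zero_le
  · rw [lintegral_indicator_const hD, one_mul]
    refine ((measure_mono hDz).trans_lt ?_).ne
    rw [gridBox_eq, Measure.pi_pi]
    exact ENNReal.prod_lt_top fun i _ => volume_prod_lt_top (gridStrip_subset k (z i))
  · have hmem : ∀ᶠ m in atTop, p ∈ D ∩ avoiding (V m) ↔ p ∈ D ∩ avoiding W := by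
      filter_upwards [eventually_all.2 fun i => hlim (p, p i)] with m hm
      exact and_congr_right fun _ => forall_congr' fun i => not_congr (hm i)
    by_cases hp : p ∈ D ∩ avoiding W
    · rw [Set.indicator_of_mem hp]
      refine (tendsto_voidProb lam (hμ p hp.1).1 (hμ p hp.1).2).congr' ?_
      filter_upwards [hmem] with m hm
      rw [Set.indicator_of_mem (hm.2 hp)]
    · rw [Set.indicator_of_notMem hp]
      refine tendsto_const_nhds.congr' ?_
      filter_upwards [hmem] with m hm
      rw [Set.indicator_of_notMem fun h => hp (hm.1 h)]

/-- As the regions increase, the void events decrease to that of the union, and both sides pass to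
the limit. -/
theorem voidTuples_iUnion [IsProbabilityMeasure P] [IsProbabilityMeasure ν]
    (hL : IsPoissonBuildingProcess lam ν P L) (hlam : 0 ≤ lam)
    {V : ℕ → Set ((Fin n → ℝ × ℝ) × (ℝ × ℝ))} (hV : ∀ m, MeasurableSet (V m)) (hmono : Monotone V)
    {D : Set (Fin n → ℝ × ℝ)} (hD : MeasurableSet D) {k : ℕ} {z : Fin n → ℤ}
    (hDz : D ⊆ gridBox k z) (hμ : ∀ p ∈ D, 𝔪(ν) (Prod.mk p ⁻¹' ⋃ m, V m) ≠ ∞)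
    (h : ∀ m, voidTuples P hL (V m) D = voidIntensity lam ν (V m) D) :
    voidTuples P hL (⋃ m, V m) D = voidIntensity lam ν (⋃ m, V m) D := by
  have hU := MeasurableSet.iUnion hV
  have hvoid : ∀ m, MeasurableSet {x : Ω × (Fin n → ℝ × ℝ) | x.2 ∈ D ∧
      pointMeasure (L x.1) (Prod.mk x.2 ⁻¹' V m) = 0} := fun m =>
    (measurable_snd hD).inter (measurableSet_void hL.landscape hL.measurable_count (hV m))
  have h1 : Tendsto (fun m => voidTuples P hL (V m) D) atTop
      (𝓝 (voidTuples P hL (⋃ m, V m) D)) := by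
    rw [voidTuples_eq_measure hL hD]
    have hset : {x : Ω × (Fin n → ℝ × ℝ) | x.2 ∈ D ∧
        pointMeasure (L x.1) (Prod.mk x.2 ⁻¹' ⋃ m, V m) = 0}
        = ⋂ m, {x | x.2 ∈ D ∧ pointMeasure (L x.1) (Prod.mk x.2 ⁻¹' V m) = 0} := by
      ext x
      simp only [Set.preimage_iUnion, measure_iUnion_null_iff, Set.mem_ofPred_eq, Set.mem_iInter]
      exact ⟨fun h m => ⟨h.1, h.2 m⟩, fun h => ⟨(h 0).1, fun m => (h m).2⟩⟩
    rw [hset]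
    simp_rw [voidTuples_eq_measure hL hD]
    refine tendsto_measure_iInter_atTop (fun m => (hvoid m).nullMeasurableSet) ?_ ⟨0, ?_⟩
    · exact fun m m' hmm' x hx => ⟨hx.1, measure_mono_null (Set.preimage_mono (hmono hmm')) hx.2⟩
    -- Continuity from above needs one event of finite measure. The equality already known for `V 0`
    -- provides it, since the intensity side is finite on a grid box.
    · rw [← voidTuples_eq_measure hL hD, h 0]
      exact ((measure_mono hDz).trans_lt (voidIntensity_gridBox_lt_top hlam k z _)).ne
  refine tendsto_nhds_unique (h1.congr h) ?_
  refine tendsto_voidIntensity hlam hV hU hD hDz (fun x => ?_) fun p hp => ⟨hμ p hp, ?_⟩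
  · by_cases hx : x ∈ ⋃ m, V m
    · obtain ⟨m, hm⟩ := Set.mem_iUnion.1 hx
      filter_upwards [eventually_ge_atTop m] with m' hm'
      exact iff_of_true (hmono hm' hm) hx
    · exact Eventually.of_forall fun m =>
        iff_of_false (fun hm => hx (Set.mem_iUnion.2 ⟨m, hm⟩)) hx
  · rw [Set.preimage_iUnion]
    exact tendsto_measure_iUnion_atTop fun m m' hmm' => Set.preimage_mono (hmono hmm')

/-- A counting measure takes integer values: once finite masses that tend to `0` drop below `1`,
they vanish. This turns an emptiness in the limit into an emptiness at a finite stage. -/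
theorem eventually_pointMeasure_eq_zero {S : Set (ℝ × ℝ)} (hS : IsLandscape S)
    {B : ℕ → Set (ℝ × ℝ)} (hB : ∀ m, MeasurableSet (B m)) (hanti : Antitone B) {a b : ℝ}
    (hab : B 0 ⊆ {q | a ≤ q.1 ∧ q.1 ≤ b}) (h : pointMeasure S (⋂ m, B m) = 0) :
    ∃ m, pointMeasure S (B m) = 0 := by
  have ht := tendsto_measure_iInter_atTop (μ := pointMeasure S)
    (fun m => (hB m).nullMeasurableSet) hanti ⟨0, (pointMeasure_lt_top hS (hB 0) hab).ne⟩
  rw [h] at ht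
  obtain ⟨m, hm⟩ := (ht.eventually (gt_mem_nhds one_pos)).exists
  refine ⟨m, ?_⟩
  rw [Function.comp_apply, pointMeasure_apply hS (hB m)] at hm
  rw [pointMeasure_apply hS (hB m)]
  have : (S ∩ B m).encard < 1 := by exact_mod_cast hm
  simpa [Order.lt_one_iff] using this

/-- As the regions decrease inside a slab, local finiteness makes the void events increase to that
of the intersection. -/
theorem voidTuples_iInter [IsProbabilityMeasure P] [IsProbabilityMeasure ν]
    (hL : IsPoissonBuildingProcess lam ν P L) (hlam : 0 ≤ lam)
    {V : ℕ → Set ((Fin n → ℝ × ℝ) × (ℝ × ℝ))} (hV : ∀ m, MeasurableSet (V m)) (hanti : Antitone V)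
    {a : ℝ} (hslab : V 0 ⊆ slab n a)
    {D : Set (Fin n → ℝ × ℝ)} (hD : MeasurableSet D) {k : ℕ} {z : Fin n → ℤ}
    (hDz : D ⊆ gridBox k z)
    (h : ∀ m, voidTuples P hL (V m) D = voidIntensity lam ν (V m) D) :
    voidTuples P hL (⋂ m, V m) D = voidIntensity lam ν (⋂ m, V m) D := by
  have hU := MeasurableSet.iInter hV
  have hsec : ∀ p m, MeasurableSet (Prod.mk p ⁻¹' V m) := fun p m => measurable_prodMk_left (hV m)
  have hsub : ∀ p : Fin n → ℝ × ℝ, Prod.mk p ⁻¹' V 0 ⊆ {q | -a ≤ q.1 ∧ q.1 ≤ a} :=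
    fun p q hq => hslab hq
  have h1 : Tendsto (fun m => voidTuples P hL (V m) D) atTop
      (𝓝 (voidTuples P hL (⋂ m, V m) D)) := by
    rw [voidTuples_eq_measure hL hD]
    have hset : {x : Ω × (Fin n → ℝ × ℝ) | x.2 ∈ D ∧
        pointMeasure (L x.1) (Prod.mk x.2 ⁻¹' ⋂ m, V m) = 0}
        = ⋃ m, {x | x.2 ∈ D ∧ pointMeasure (L x.1) (Prod.mk x.2 ⁻¹' V m) = 0} := by
      ext x
      simp only [Set.mem_ofPred_eq, Set.mem_iUnion]
      constructor
      · rintro ⟨hx, h0⟩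
        rw [Set.preimage_iInter] at h0
        obtain ⟨m, hm⟩ := eventually_pointMeasure_eq_zero (hL.landscape x.1) (hsec x.2)
          (fun m m' hmm' => Set.preimage_mono (hanti hmm')) (hsub x.2) h0
        exact ⟨m, hx, hm⟩
      · rintro ⟨m, hx, hm⟩
        exact ⟨hx, measure_mono_null (Set.preimage_mono (Set.iInter_subset _ m)) hm⟩
    rw [hset]
    simp_rw [voidTuples_eq_measure hL hD]
    exact tendsto_measure_iUnion_atTop fun m m' hmm' x hx =>
      ⟨hx.1, measure_mono_null (Set.preimage_mono (hanti hmm')) hx.2⟩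
  refine tendsto_nhds_unique (h1.congr h) ?_
  have hfin : ∀ p m, 𝔪(ν) (Prod.mk p ⁻¹' V m) ≠ ∞ := fun p m =>
    (volume_prod_lt_top ((Set.preimage_mono (hanti (Nat.zero_le m))).trans (hsub p))).ne
  refine tendsto_voidIntensity hlam hV hU hD hDz (fun x => ?_) fun p hp => ⟨?_, ?_⟩
  · by_cases hx : x ∈ ⋂ m, V m
    · exact Eventually.of_forall fun m => iff_of_true (Set.mem_iInter.1 hx m) hx
    · obtain ⟨m, hm⟩ := not_forall.1 (fun h' => hx (Set.mem_iInter.2 h'))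
      filter_upwards [eventually_ge_atTop m] with m' hm'
      exact iff_of_false (fun h' => hm (hanti hm' h')) hx
  · exact ((measure_mono (Set.preimage_mono (Set.iInter_subset _ 0))).trans_lt
      (hfin p 0).lt_top).ne
  · rw [Set.preimage_iInter]
    exact tendsto_measure_iInter_atTop (fun m => (hsec p m).nullMeasurableSet)
      (fun m m' hmm' => Set.preimage_mono (hanti hmm')) ⟨0, hfin p 0⟩

theorem voidTuples_gridBox [IsProbabilityMeasure P] [IsProbabilityMeasure ν]
    (hL : IsPoissonBuildingProcess lam ν P L) (hlam : 0 ≤ lam)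
    {V : Set ((Fin n → ℝ × ℝ) × (ℝ × ℝ))} (hV : MeasurableSet V)
    {D : Set (Fin n → ℝ × ℝ)} (hD : MeasurableSet D) {k : ℕ} {z : Fin n → ℤ}
    (hz : Function.Injective z) (hDz : D ⊆ gridBox k z)
    (hμ : ∀ p ∈ D, 𝔪(ν) (Prod.mk p ⁻¹' V) ≠ ∞) :
    voidTuples P hL V D = voidIntensity lam ν V D := by
  have hslab : ∀ a : ℝ, voidTuples P hL (V ∩ slab n a) D
      = voidIntensity lam ν (V ∩ slab n a) D := by
    intro a
    have hmc := MonotoneClass.of_generateFrom isSetAlgebra_simpleRegions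
      (measurableSet_generateFrom_simpleRegions hV)
    -- Measurability is carried along the induction, because the limit lemmas require it at each
    -- stage. Finite intensity is not inherited by the members of the class; the slab supplies it
    -- instead.
    suffices H : MeasurableSet V ∧
        voidTuples P hL (V ∩ slab n a) D = voidIntensity lam ν (V ∩ slab n a) D from H.2
    clear hμ hV
    induction hmc with
    | basic V hV =>
      refine ⟨measurableSet_of_mem_simpleRegions hV, ?_⟩
      have := congrArg (fun κ => κ D) (voidTuples_simple hL hlam hV a (k := k) hz)
      rwa [Measure.restrict_apply hD, Measure.restrict_apply hD,
        Set.inter_eq_self_of_subset_left hDz] at this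
    | iUnion f hf _ ih =>
      refine ⟨MeasurableSet.iUnion fun m => (ih m).1, ?_⟩
      rw [Set.iUnion_inter]
      refine voidTuples_iUnion hL hlam (fun m => (ih m).1.inter (measurableSet_slab a))
        (fun m m' hmm' => Set.inter_subset_inter_left _ (hf hmm')) hD hDz (fun p _ => ?_)
        fun m => (ih m).2
      rw [← Set.iUnion_inter]
      exact (volume_prod_lt_top (a := -a) (b := a) fun q hq => hq.2).ne
    | iInter f hf _ ih =>
      refine ⟨MeasurableSet.iInter fun m => (ih m).1, ?_⟩
      rw [Set.iInter_inter]
      exact voidTuples_iInter hL hlam (fun m => (ih m).1.inter (measurableSet_slab a))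
        (fun m m' hmm' => Set.inter_subset_inter_left _ (hf hmm')) Set.inter_subset_right hD hDz
        fun m => (ih m).2
  have hU : V = ⋃ m : ℕ, V ∩ slab n m := by
    ext x
    simp only [Set.mem_iUnion, Set.mem_inter_iff, exists_and_left]
    refine ⟨fun hx => ⟨hx, ?_⟩, fun h => h.1⟩
    obtain ⟨m, hm⟩ := exists_nat_ge |x.2.1|
    exact ⟨m, abs_le.1 hm⟩
  rw [hU] at hμ ⊢
  refine voidTuples_iUnion hL hlam (fun m => hV.inter (measurableSet_slab _))
    (fun m m' hmm' x hx => ⟨hx.1, ?_, ?_⟩) hD hDz hμ fun m => hslab m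
  · have : (m : ℝ) ≤ m' := by exact_mod_cast hmm'
    linarith [hx.2.1]
  · have : (m : ℝ) ≤ m' := by exact_mod_cast hmm'
    linarith [hx.2.2]

/-- A grid whose mesh is below the smallest gap between the bases puts them in distinct cells. -/
theorem exists_mem_gridBox {p : Fin n → ℝ × ℝ} (hp : Function.Injective fun i => (p i).1) :
    ∃ (k : ℕ) (z : Fin n → ℤ), Function.Injective z ∧ p ∈ gridBox k z := by
  have h : ∀ i j : Fin n, ∀ᶠ k : ℕ in atTop,
      ⌊(k + 1 : ℝ) * (p i).1⌋ = ⌊(k + 1 : ℝ) * (p j).1⌋ → i = j := by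
    intro i j
    by_cases hij : i = j
    · exact Eventually.of_forall fun _ _ => hij
    have hd : 0 < |(p i).1 - (p j).1| := abs_pos.2 (sub_ne_zero.2 (hp.ne hij))
    obtain ⟨K, hK⟩ := exists_nat_gt (1 / |(p i).1 - (p j).1|)
    filter_upwards [eventually_ge_atTop K] with k hk heq
    have h1 := Int.abs_sub_lt_one_of_floor_eq_floor heq
    rw [← mul_sub, abs_mul, abs_of_nonneg (by positivity : (0 : ℝ) ≤ k + 1)] at h1
    rw [div_lt_iff₀ hd] at hK
    have : (K : ℝ) ≤ k := by exact_mod_cast hk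
    nlinarith
  obtain ⟨k, hk⟩ := (eventually_all.2 fun i => eventually_all.2 (h i)).exists
  exact ⟨k, fun i => ⌊(k + 1 : ℝ) * (p i).1⌋, fun i j hij => hk i j hij, fun i => rfl⟩

/-- The multivariate Mecke formula for void probabilities. -/
theorem IsPoissonBuildingProcess.lintegral_void [IsProbabilityMeasure P] [IsProbabilityMeasure ν]
    (hL : IsPoissonBuildingProcess lam ν P L) (hlam : 0 ≤ lam)
    {V : Set ((Fin n → ℝ × ℝ) × (ℝ × ℝ))} (hV : MeasurableSet V)
    {D : Set (Fin n → ℝ × ℝ)} (hD : MeasurableSet D)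
    (hinj : ∀ p ∈ D, Function.Injective fun i => (p i).1)
    (hμ : ∀ p ∈ D, 𝔪(ν) (Prod.mk p ⁻¹' V) ≠ ∞) :
    ∫⁻ ω, tupleMeasure (L ω) n {p | p ∈ D ∧ pointMeasure (L ω) (Prod.mk p ⁻¹' V) = 0} ∂P
      = ENNReal.ofReal lam ^ n *
        ∫⁻ p in D ∩ avoiding V, voidProb lam ν (Prod.mk p ⁻¹' V)
          ∂(Measure.pi fun _ => 𝔪(ν)) := by
  rw [← voidTuples_apply hL hV hD, ← voidIntensity_apply hD]
  -- Countably many boxes with distinct cells cover `D`. Boxes of different meshes overlap, so the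
  -- two measures are compared by restriction rather than by summation.
  let J : ℕ × {z : Fin n → ℤ // Function.Injective z} → Set (Fin n → ℝ × ℝ) :=
    fun i => D ∩ gridBox i.1 i.2
  have hJ : ∀ i, MeasurableSet (J i) := fun i => hD.inter (measurableSet_gridBox _ _)
  have hDJ : D = ⋃ i, J i := by
    ext p
    simp only [J, Set.mem_iUnion, Set.mem_inter_iff, exists_and_left]
    refine ⟨fun hp => ⟨hp, ?_⟩, fun h => h.1⟩
    obtain ⟨k, z, hz, hpz⟩ := exists_mem_gridBox (hinj p hp)
    exact ⟨(k, ⟨z, hz⟩), hpz⟩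
  have key : (voidTuples P hL V).restrict D = (voidIntensity lam ν V).restrict D := by
    rw [hDJ, Measure.restrict_iUnion_congr]
    intro i
    ext E hE
    rw [Measure.restrict_apply hE, Measure.restrict_apply hE]
    exact voidTuples_gridBox hL hlam hV (hE.inter (hJ i)) i.2.2
      (Set.inter_subset_right.trans Set.inter_subset_right) fun p hp => hμ p hp.2.1
  rw [← Measure.restrict_apply_self, key, Measure.restrict_apply_self]

end

/-! Blockage chains as tuples of buildings with a void region. -/

/-- The region that contains no building when `q` is the blocking building of `p`. -/
def hopRegion (R : ℝ) (p q : ℝ × ℝ) : Set (ℝ × ℝ) :=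
  {r | p.1 < r.1 ∧ r.1 ≤ p.1 + R ∧
    (slopeTo p q < slopeTo p r ∨ (slopeTo p q = slopeTo p r ∧ r.1 < q.1))}

/-- This turns the argmax into a void event, the kind of event the Mecke formula handles. The
tie-break to the left is the second alternative in `hopRegion`. -/
theorem isBlocking_iff {R : ℝ} {S : Set (ℝ × ℝ)} {p q : ℝ × ℝ} :
    IsBlocking R S p q ↔
      q ∈ S ∧ (p.1 < q.1 ∧ q.1 ≤ p.1 + R) ∧ S ∩ hopRegion R p q = ∅ := by
  constructor
  · rintro ⟨⟨⟨hqS, hq⟩, hmax⟩, hleft⟩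
    refine ⟨hqS, hq, Set.eq_empty_iff_forall_notMem.2 ?_⟩
    rintro r ⟨hrS, h1, h2, h3 | ⟨h3, h4⟩⟩
    · exact absurd (hmax r ⟨hrS, h1, h2⟩) (not_le.2 h3)
    · refine absurd (hleft r ⟨⟨hrS, h1, h2⟩, fun s hs => ?_⟩) (not_le.2 h4)
      rw [← h3]
      exact hmax s hs
  · rintro ⟨hqS, hq, hempty⟩
    have hno := Set.eq_empty_iff_forall_notMem.1 hempty
    refine ⟨⟨⟨hqS, hq⟩, fun r hr => ?_⟩, fun r hr => ?_⟩
    · by_contra h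
      exact hno r ⟨hr.1, hr.2.1, hr.2.2, Or.inl (not_le.1 h)⟩
    · by_contra h
      have h1 := hr.2 q ⟨hqS, hq⟩
      rcases h1.lt_or_eq with h2 | h2
      · exact hno r ⟨hr.1.1, hr.1.2.1, hr.1.2.2, Or.inl h2⟩
      · exact hno r ⟨hr.1.1, hr.1.2.1, hr.1.2.2, Or.inr ⟨h2, not_le.1 h⟩⟩

theorem block_eq_some_iff {R : ℝ} {S : Set (ℝ × ℝ)} {p q : ℝ × ℝ} :
    block R S p = some q ↔ IsBlocking R S p q := by
  unfold block
  split_ifs with h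
  · rw [Option.some_inj]
    exact ⟨fun h' => h' ▸ h.choose_spec, fun h' => h.choose_spec.unique h'⟩
  · simp only [false_iff]
    exact fun h' => h ⟨q, h'⟩

/-- The sequence with term `0` at `o` and terms `1, …, n` given by `p`. -/
def startAt {n : ℕ} (o : ℝ × ℝ) (p : Fin n → ℝ × ℝ) (i : ℕ) : ℝ × ℝ :=
  if h : 1 ≤ i ∧ i ≤ n then p ⟨i - 1, by omega⟩ else o

theorem startAt_zero {n : ℕ} (o : ℝ × ℝ) (p : Fin n → ℝ × ℝ) : startAt o p 0 = o := by
  simp [startAt]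

theorem startAt_succ {n : ℕ} (o : ℝ × ℝ) (p : Fin n → ℝ × ℝ) (i : Fin n) :
    startAt o p (i + 1) = p i := by
  have : (i : ℕ) + 1 ≤ n := i.2
  simp [startAt, this]

theorem startAt_snoc {n : ℕ} (o : ℝ × ℝ) (p : Fin n → ℝ × ℝ) (b : ℝ × ℝ) {i : ℕ} (hi : i ≤ n) :
    startAt o (Fin.snoc p b : Fin (n + 1) → ℝ × ℝ) i = startAt o p i := by
  rcases i with _ | i
  · rw [startAt_zero, startAt_zero]
  · have h1 := startAt_succ o (Fin.snoc p b : Fin (n + 1) → ℝ × ℝ) (Fin.castSucc ⟨i, hi⟩)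
    have h2 := startAt_succ o p ⟨i, hi⟩
    rw [Fin.snoc_castSucc] at h1
    exact h1.trans h2.symm

theorem startAt_snoc_last {n : ℕ} (o : ℝ × ℝ) (p : Fin n → ℝ × ℝ) (b : ℝ × ℝ) :
    startAt o (Fin.snoc p b : Fin (n + 1) → ℝ × ℝ) (n + 1) = b := by
  have h1 := startAt_succ o (Fin.snoc p b : Fin (n + 1) → ℝ × ℝ) (Fin.last n)
  rwa [Fin.snoc_last] at h1

theorem exists_startAt (n : ℕ) (q : ℕ → ℝ × ℝ) :
    ∃ p : Fin n → ℝ × ℝ, ∀ i ≤ n, startAt (q 0) p i = q i := by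
  refine ⟨fun i => q (i + 1), fun i hi => ?_⟩
  rcases i with _ | i
  · exact startAt_zero _ _
  · exact startAt_succ (q 0) (fun i : Fin n => q (i + 1)) ⟨i, hi⟩

/-- Each of the first `n` hops has length in `]0, R]`. -/
def InReach (R : ℝ) (q : ℕ → ℝ × ℝ) (n : ℕ) : Prop :=
  ∀ i < n, (q i).1 < (q (i + 1)).1 ∧ (q (i + 1)).1 ≤ (q i).1 + R

/-- The region that contains no building when each of the first `n` hops of `q` leads to the
blocking building. -/
def chainRegion (R : ℝ) (q : ℕ → ℝ × ℝ) (n : ℕ) : Set (ℝ × ℝ) :=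
  {r | ∃ i < n, r ∈ hopRegion R (q i) (q (i + 1))}

theorem InReach.base_lt {R : ℝ} {q : ℕ → ℝ × ℝ} {n : ℕ} (h : InReach R q n) {i j : ℕ}
    (hij : i < j) (hj : j ≤ n) : (q i).1 < (q j).1 := by
  induction j with
  | zero => omega
  | succ j ih =>
    rcases Nat.lt_succ_iff_lt_or_eq.1 hij with h1 | rfl
    · exact (ih h1 (by omega)).trans (h j (by omega)).1
    · exact (h i (by omega)).1

theorem InReach.base_le {R : ℝ} {q : ℕ → ℝ × ℝ} {n : ℕ} (h : InReach R q n) {i j : ℕ}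
    (hij : i ≤ j) (hj : j ≤ n) : (q i).1 ≤ (q j).1 := by
  rcases hij.lt_or_eq with h1 | rfl
  · exact (h.base_lt h1 hj).le
  · exact le_rfl

/-- Bases increase strictly along the chain; this is the injectivity of bases that `lintegral_void`
asks for. -/
theorem InReach.injective_base {R : ℝ} {o : ℝ × ℝ} {n : ℕ} {p : Fin n → ℝ × ℝ}
    (h : InReach R (startAt o p) n) : Function.Injective fun i => (p i).1 := by
  have hlt : ∀ i j : Fin n, i < j → (p i).1 < (p j).1 := by
    intro i j hij
    rw [← startAt_succ o p i, ← startAt_succ o p j]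
    exact h.base_lt (by simpa using hij) j.2
  intro i j hij
  rcases lt_trichotomy i j with h1 | h1 | h1
  · exact absurd hij (hlt i j h1).ne
  · exact h1
  · exact absurd hij (hlt j i h1).ne'

/-- `q` is a chain of `n` blocking buildings of `S`. -/
def IsBlockingChain (R : ℝ) (S : Set (ℝ × ℝ)) (q : ℕ → ℝ × ℝ) (n : ℕ) : Prop :=
  ∀ i < n, IsBlocking R S (q i) (q (i + 1))

theorem isBlockingChain_iff {R : ℝ} {S : Set (ℝ × ℝ)} {q : ℕ → ℝ × ℝ} {n : ℕ} :
    IsBlockingChain R S q n ↔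
      (∀ i < n, q (i + 1) ∈ S) ∧ InReach R q n ∧ S ∩ chainRegion R q n = ∅ := by
  simp only [IsBlockingChain, isBlocking_iff, Set.eq_empty_iff_forall_notMem]
  constructor
  · intro h
    refine ⟨fun i hi => (h i hi).1, fun i hi => (h i hi).2.1, ?_⟩
    rintro r ⟨hr, i, hi, hri⟩
    exact (h i hi).2.2 r ⟨hr, hri⟩
  · rintro ⟨h1, h2, h3⟩ i hi
    exact ⟨h1 i hi, h2 i hi, fun r hr => h3 r ⟨hr.1, i, hi, hr.2⟩⟩

theorem IsBlockingChain.unique {R : ℝ} {S : Set (ℝ × ℝ)} {q q' : ℕ → ℝ × ℝ} {n : ℕ}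
    (h : IsBlockingChain R S q n) (h' : IsBlockingChain R S q' n) (h0 : q 0 = q' 0) :
    ∀ i ≤ n, q i = q' i := by
  intro i hi
  induction i with
  | zero => exact h0
  | succ i ih =>
    have h1 := h i (by omega)
    rw [ih (by omega)] at h1
    exact h1.unique (h' i (by omega))

theorem blockSeq_eq_some_iff {R : ℝ} {S : Set (ℝ × ℝ)} {o b : ℝ × ℝ} {n : ℕ} :
    blockSeq R S o n = some b ↔ ∃ q : ℕ → ℝ × ℝ, q 0 = o ∧ q n = b ∧ IsBlockingChain R S q n := by
  induction n generalizing b with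
  | zero =>
    rw [blockSeq, Option.some_inj]
    constructor
    · rintro rfl
      exact ⟨fun _ => o, rfl, rfl, fun i hi => absurd hi (Nat.not_lt_zero i)⟩
    · rintro ⟨q, rfl, rfl, -⟩
      rfl
  | succ n ih =>
    rw [blockSeq, Option.bind_eq_some_iff]
    simp only [ih, block_eq_some_iff]
    constructor
    · rintro ⟨c, ⟨q, h0, hn, hq⟩, hc⟩
      refine ⟨fun i => if i ≤ n then q i else b, by simpa using h0, by simp, fun i hi => ?_⟩
      rcases Nat.lt_succ_iff_lt_or_eq.1 hi with h1 | rfl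
      · have h2 : i + 1 ≤ n := h1
        simpa [h1.le, h2] using hq i h1
      · simpa [hn] using hc
    · rintro ⟨q, h0, hn, hq⟩
      refine ⟨q n, ⟨q, h0, rfl, fun i hi => hq i (by omega)⟩, ?_⟩
      rw [← hn]
      exact hq n (by omega)

theorem isBlockingChain_congr {R : ℝ} {S : Set (ℝ × ℝ)} {q q' : ℕ → ℝ × ℝ} {n : ℕ}
    (h : ∀ i ≤ n, q i = q' i) : IsBlockingChain R S q n ↔ IsBlockingChain R S q' n := by
  refine forall_congr' fun i => forall_congr' fun hi => ?_
  rw [h i (by omega), h (i + 1) (by omega)]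

theorem isBlockingChain_startAt_iff {R : ℝ} {S : Set (ℝ × ℝ)} {o : ℝ × ℝ} {n : ℕ}
    {p : Fin n → ℝ × ℝ} :
    IsBlockingChain R S (startAt o p) n ↔ (∀ i, p i ∈ S) ∧ InReach R (startAt o p) n ∧
      S ∩ chainRegion R (startAt o p) n = ∅ := by
  rw [isBlockingChain_iff]
  refine and_congr_left fun _ => ⟨fun h i => ?_, fun h i hi => ?_⟩
  · rw [← startAt_succ o p i]
    exact h i i.2
  · rw [startAt_succ o p ⟨i, hi⟩]
    exact h _

/-- The blockage sequence of `o` reaches a building at step `n` exactly when some `n`-tuple of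
buildings is a blocking chain. -/
theorem blockSeq_ne_none_iff {R : ℝ} {S : Set (ℝ × ℝ)} {o : ℝ × ℝ} {n : ℕ} :
    blockSeq R S o n ≠ none ↔ ∃ p : Fin n → ℝ × ℝ, (∀ i, p i ∈ S) ∧
      InReach R (startAt o p) n ∧ S ∩ chainRegion R (startAt o p) n = ∅ := by
  rw [Option.ne_none_iff_exists']
  simp only [blockSeq_eq_some_iff, ← isBlockingChain_startAt_iff]
  constructor
  · rintro ⟨b, q, rfl, -, hq⟩
    obtain ⟨p, hp⟩ := exists_startAt n q
    exact ⟨p, (isBlockingChain_congr hp).2 hq⟩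
  · rintro ⟨p, hp⟩
    exact ⟨_, _, startAt_zero o p, rfl, hp⟩

/-- The chains that lead to an added building `b`. -/
theorem blockSeq_insert_eq_some_iff {R : ℝ} {S : Set (ℝ × ℝ)} {o b : ℝ × ℝ} {n : ℕ} :
    blockSeq R (S ∪ {b}) o (n + 1) = some b ↔ ∃ p : Fin n → ℝ × ℝ, (∀ i, p i ∈ S) ∧
      (InReach R (startAt o (Fin.snoc p b : Fin (n + 1) → ℝ × ℝ)) (n + 1) ∧
        b ∉ chainRegion R (startAt o (Fin.snoc p b : Fin (n + 1) → ℝ × ℝ)) (n + 1)) ∧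
      S ∩ chainRegion R (startAt o (Fin.snoc p b : Fin (n + 1) → ℝ × ℝ)) (n + 1) = ∅ := by
  have hempty : ∀ W : Set (ℝ × ℝ), (S ∪ {b}) ∩ W = ∅ ↔ b ∉ W ∧ S ∩ W = ∅ := by
    intro W
    rw [Set.union_inter_distrib_right, Set.union_empty_iff, and_comm,
      Set.singleton_inter_eq_empty]
  rw [blockSeq_eq_some_iff]
  constructor
  · rintro ⟨q, rfl, rfl, hq⟩
    obtain ⟨p, hp⟩ := exists_startAt n q
    have hs : ∀ i ≤ n + 1,
        startAt (q 0) (Fin.snoc p (q (n + 1)) : Fin (n + 1) → ℝ × ℝ) i = q i := by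
      intro i hi
      rcases Nat.le_succ_iff.1 hi with h | rfl
      · rw [startAt_snoc _ _ _ h, hp i h]
      · exact startAt_snoc_last _ _ _
    have hq' := isBlockingChain_startAt_iff.1 ((isBlockingChain_congr hs).2 hq)
    rw [hempty] at hq'
    refine ⟨p, fun i => ?_, ⟨hq'.2.1, hq'.2.2.1⟩, hq'.2.2.2⟩
    have h1 := hq'.1 i.castSucc
    rw [Fin.snoc_castSucc] at h1
    -- An intermediate building cannot be `b`, since `b` ends the chain and the bases increase
    -- strictly; it therefore belongs to `S`.
    refine h1.resolve_right fun h2 => ?_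
    have h3 := hq'.2.1.base_lt (i := i + 1) (j := n + 1) (by omega) le_rfl
    rw [startAt_snoc_last, startAt_snoc _ _ _ i.2, startAt_succ, h2] at h3
    exact lt_irrefl _ h3
  · rintro ⟨p, hpS, ⟨hreach, hb⟩, hvoid⟩
    refine ⟨_, startAt_zero _ _, startAt_snoc_last o p b, isBlockingChain_startAt_iff.2
      ⟨fun i => ?_, hreach, (hempty _).2 ⟨hb, hvoid⟩⟩⟩
    refine Fin.lastCases ?_ (fun i => ?_) i
    · rw [Fin.snoc_last]; exact Or.inr rfl
    · rw [Fin.snoc_castSucc]; exact Or.inl (hpS i)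

/-- The blockage sequence visits a point at most once. -/
theorem blockSeq_step_unique {R : ℝ} {S : Set (ℝ × ℝ)} {o b : ℝ × ℝ} {m n : ℕ}
    (hm : blockSeq R S o m = some b) (hn : blockSeq R S o n = some b) : m = n := by
  have key : ∀ {m n : ℕ}, m < n → blockSeq R S o m = some b → blockSeq R S o n ≠ some b := by
    intro m n hmn hm hn
    obtain ⟨q, h0, hqm, hq⟩ := blockSeq_eq_some_iff.1 hm
    obtain ⟨q', h0', hqn, hq'⟩ := blockSeq_eq_some_iff.1 hn
    have hlt := (isBlockingChain_iff.1 hq').2.1.base_lt hmn le_rfl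
    have hsub : IsBlockingChain R S q' m := fun i hi => hq' i (hi.trans hmn)
    rw [← hq.unique hsub (h0.trans h0'.symm) m le_rfl, hqm, hqn] at hlt
    exact lt_irrefl _ hlt
  rcases lt_trichotomy m n with h | h | h
  · exact absurd hn (key h hm)
  · exact h
  · exact absurd hm (key h hn)

theorem blockSeq_eq_none_of_le {R : ℝ} {S : Set (ℝ × ℝ)} {o : ℝ × ℝ} {m n : ℕ} (hmn : m ≤ n)
    (hm : blockSeq R S o m = none) : blockSeq R S o n = none := by
  induction n, hmn using Nat.le_induction with
  | base => exact hm
  | succ n _ ih => rw [blockSeq, ih, Option.bind_none]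

theorem chain_succ_eq_cemetery_iff {R : ℝ} {S : Set (ℝ × ℝ)} {n : ℕ} :
    chain R S (n + 1) = cemetery ↔ blockSeq R S (0, 0) (n + 1) = none := by
  rw [chain]
  constructor
  · intro h
    by_contra h1
    obtain ⟨q, hq⟩ := Option.ne_none_iff_exists'.1 h1
    obtain ⟨p, hp⟩ := Option.ne_none_iff_exists'.1
      fun h2 => h1 (blockSeq_eq_none_of_le (Nat.le_succ n) h2)
    rw [hq, hp] at h
    exact EReal.coe_ne_bot _ (congrArg Prod.fst h)
  · intro h
    rw [h]
    cases blockSeq R S (0, 0) n <;> rfl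

-- Once the sequence has died it stays dead, so the steps that exist form an initial segment, and
-- counting them gives its length, possibly infinite.
open Classical in
theorem hopsBeforeCemetery_eq_tsum (R : ℝ) (S : Set (ℝ × ℝ)) :
    hopsBeforeCemetery R S
      = ∑' n : ℕ, if blockSeq R S (0, 0) (n + 1) ≠ none then (1 : ℝ≥0∞) else 0 := by
  simp only [hopsBeforeCemetery, chain_succ_eq_cemetery_iff]
  by_cases h : ∃ n, blockSeq R S (0, 0) (n + 1) = none
  · have hN := Nat.find_spec h
    rw [tsum_eq_sum (s := Finset.range (Nat.find h))]
    · rw [Finset.sum_congr rfl fun n hn =>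
        if_pos (Nat.find_min h (Finset.mem_range.1 hn))]
      rw [Finset.sum_const, Finset.card_range, nsmul_one]
      refine le_antisymm (iInf₂_le_of_le (Nat.find h) hN le_rfl) (le_iInf₂ fun n hn => ?_)
      exact_mod_cast Nat.find_min' h hn
    · intro n hn
      rw [Finset.mem_range, not_lt] at hn
      rw [if_neg (not_not.2 (blockSeq_eq_none_of_le (by omega) hN))]
  · have h' : ∀ n, blockSeq R S (0, 0) (n + 1) ≠ none := fun n hn => h ⟨n, hn⟩
    simp [h']

/-! Measurability. -/

theorem measurable_startAt {n : ℕ} (i : ℕ) :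
    Measurable fun y : (ℝ × ℝ) × (Fin n → ℝ × ℝ) => startAt y.1 y.2 i := by
  unfold startAt
  split_ifs with h
  · exact (measurable_pi_apply _).comp measurable_snd
  · exact measurable_fst

theorem measurableSet_inReach (R : ℝ) (n : ℕ) :
    MeasurableSet {y : (ℝ × ℝ) × (Fin n → ℝ × ℝ) | InReach R (startAt y.1 y.2) n} := by
  have h := fun i => (measurable_startAt (n := n) i).fst
  have : {y : (ℝ × ℝ) × (Fin n → ℝ × ℝ) | InReach R (startAt y.1 y.2) n}
      = ⋂ i, ⋂ (_ : i < n), ({y | (startAt y.1 y.2 i).1 < (startAt y.1 y.2 (i + 1)).1} ∩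
        {y | (startAt y.1 y.2 (i + 1)).1 ≤ (startAt y.1 y.2 i).1 + R}) := by
    ext y; simp [InReach]
  rw [this]
  exact MeasurableSet.iInter fun i => MeasurableSet.iInter fun _ =>
    (measurableSet_lt (h i) (h (i + 1))).inter
      (measurableSet_le (h (i + 1)) ((h i).add_const R))

theorem measurable_slopeTo : Measurable fun y : (ℝ × ℝ) × (ℝ × ℝ) => slopeTo y.1 y.2 := by
  unfold slopeTo
  fun_prop

theorem measurableSet_hopRegion (R : ℝ) :
    MeasurableSet {y : ((ℝ × ℝ) × (ℝ × ℝ)) × (ℝ × ℝ) | y.2 ∈ hopRegion R y.1.1 y.1.2} := by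
  have h1 : Measurable fun y : ((ℝ × ℝ) × (ℝ × ℝ)) × (ℝ × ℝ) => slopeTo y.1.1 y.1.2 :=
    measurable_slopeTo.comp measurable_fst
  have h2 : Measurable fun y : ((ℝ × ℝ) × (ℝ × ℝ)) × (ℝ × ℝ) => slopeTo y.1.1 y.2 :=
    measurable_slopeTo.comp (measurable_fst.fst.prodMk measurable_snd)
  have h3 : Measurable fun y : ((ℝ × ℝ) × (ℝ × ℝ)) × (ℝ × ℝ) => y.1.1.1 := by fun_prop
  have h4 : Measurable fun y : ((ℝ × ℝ) × (ℝ × ℝ)) × (ℝ × ℝ) => y.1.2.1 := by fun_prop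
  have h5 : Measurable fun y : ((ℝ × ℝ) × (ℝ × ℝ)) × (ℝ × ℝ) => y.2.1 := by fun_prop
  exact (measurableSet_lt h3 h5).inter ((measurableSet_le h5 (h3.add_const R)).inter
    ((measurableSet_lt h1 h2).union ((measurableSet_eq_fun h1 h2).inter (measurableSet_lt h5 h4))))

theorem measurableSet_chainRegion (R : ℝ) (n : ℕ) :
    MeasurableSet {y : ((ℝ × ℝ) × (Fin n → ℝ × ℝ)) × (ℝ × ℝ) |
      y.2 ∈ chainRegion R (startAt y.1.1 y.1.2) n} := by
  have : {y : ((ℝ × ℝ) × (Fin n → ℝ × ℝ)) × (ℝ × ℝ) |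
      y.2 ∈ chainRegion R (startAt y.1.1 y.1.2) n}
      = ⋃ i, ⋃ (_ : i < n),
        (fun y => ((startAt y.1.1 y.1.2 i, startAt y.1.1 y.1.2 (i + 1)), y.2)) ⁻¹'
        {y : ((ℝ × ℝ) × (ℝ × ℝ)) × (ℝ × ℝ) | y.2 ∈ hopRegion R y.1.1 y.1.2} := by
    ext y; simp [chainRegion]
  rw [this]
  refine MeasurableSet.iUnion fun i => MeasurableSet.iUnion fun _ => ?_
  exact ((((measurable_startAt i).comp measurable_fst).prodMk
    ((measurable_startAt (i + 1)).comp measurable_fst)).prodMk measurable_snd)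
      (measurableSet_hopRegion R)

theorem chainRegion_subset {R : ℝ} {q : ℕ → ℝ × ℝ} {n : ℕ} (h : InReach R q n) :
    chainRegion R q n ⊆ {r | (q 0).1 ≤ r.1 ∧ r.1 ≤ (q n).1 + R} := by
  rintro r ⟨i, hi, h1, h2, -⟩
  exact ⟨(h.base_le (Nat.zero_le i) hi.le).trans h1.le,
    h2.trans (add_le_add (h.base_le hi.le le_rfl) le_rfl)⟩

section

variable {n : ℕ}

/-- The chain tuples whose void region contains none of their own points. -/
def freeChains (R : ℝ) (n : ℕ) : Set ((ℝ × ℝ) × (Fin n → ℝ × ℝ)) :=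
  {y | InReach R (startAt y.1 y.2) n ∧ ∀ i, y.2 i ∉ chainRegion R (startAt y.1 y.2) n}

theorem measurableSet_freeChains (R : ℝ) : MeasurableSet (freeChains R n) := by
  have : freeChains R n = {y | InReach R (startAt y.1 y.2) n} ∩
      ⋂ i, (fun y : (ℝ × ℝ) × (Fin n → ℝ × ℝ) => (y, y.2 i)) ⁻¹'
        {y | y.2 ∈ chainRegion R (startAt y.1.1 y.1.2) n}ᶜ := by
    ext y; simp [freeChains]
  rw [this]
  refine (measurableSet_inReach R n).inter (MeasurableSet.iInter fun i => ?_)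
  exact (measurable_id.prodMk ((measurable_pi_apply i).comp measurable_snd))
    (measurableSet_chainRegion R n).compl

/-- The unnormalized density of the first `n` blocking buildings. -/
noncomputable def chainWeight (lam R : ℝ) (ν : Measure ℝ) (y : (ℝ × ℝ) × (Fin n → ℝ × ℝ)) :
    ℝ≥0∞ :=
  (freeChains R n).indicator
    (fun y => voidProb lam ν (chainRegion R (startAt y.1 y.2) n)) y

theorem measurable_chainWeight (lam R : ℝ) (ν : Measure ℝ) [SFinite ν] :
    Measurable (chainWeight (n := n) lam R ν) :=
  (measurable_voidProb lam ν (measurableSet_chainRegion R n)).indicator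
    (measurableSet_freeChains R)

variable {Ω : Type*} [MeasurableSpace Ω] {P : Measure Ω} [IsProbabilityMeasure P]
  {lam R : ℝ} {ν : Measure ℝ} [IsProbabilityMeasure ν] {L : Ω → Set (ℝ × ℝ)}

-- A blocking chain is determined by its starting point, so the set on the right contains at most
-- one tuple of buildings and has mass `0` or `1`.
open Classical in
theorem ite_blockSeq_ne_none {S : Set (ℝ × ℝ)} (hS : IsLandscape S) (o : ℝ × ℝ) :
    (if blockSeq R S o n ≠ none then (1 : ℝ≥0∞) else 0)
      = tupleMeasure S n {p | InReach R (startAt o p) n ∧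
          pointMeasure S (chainRegion R (startAt o p) n) = 0} := by
  have hm : ∀ p : Fin n → ℝ × ℝ, MeasurableSet (chainRegion R (startAt o p) n) := fun p =>
    measurable_prodMk_left (x := (o, p)) (measurableSet_chainRegion R n)
  rw [tupleMeasure_eq_ite hS]
  · refine if_congr ?_ rfl rfl
    rw [blockSeq_ne_none_iff]
    simp only [Set.mem_ofPred_eq, pointMeasure_eq_zero_iff hS (hm _)]
    exact ⟨fun ⟨p, h1, h2⟩ => ⟨p, h2, h1⟩, fun ⟨p, h2, h1⟩ => ⟨p, h1, h2⟩⟩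
  · intro p hp p' hp' hpS hpS'
    simp only [Set.mem_ofPred_eq, pointMeasure_eq_zero_iff hS (hm _)] at hp hp'
    have h := (isBlockingChain_startAt_iff.2 ⟨hpS, hp⟩).unique
      (isBlockingChain_startAt_iff.2 ⟨hpS', hp'⟩) (by rw [startAt_zero, startAt_zero])
    ext1 i
    rw [← startAt_succ o p i, ← startAt_succ o p' i]
    exact h _ i.2

open Classical in
theorem ite_blockSeq_insert {S : Set (ℝ × ℝ)} (hS : IsLandscape S) (o b : ℝ × ℝ) :
    (if blockSeq R (S ∪ {b}) o (n + 1) = some b then (1 : ℝ≥0∞) else 0)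
      = tupleMeasure S n {p |
          (InReach R (startAt o (Fin.snoc p b : Fin (n + 1) → ℝ × ℝ)) (n + 1) ∧
            b ∉ chainRegion R (startAt o (Fin.snoc p b : Fin (n + 1) → ℝ × ℝ)) (n + 1)) ∧
          pointMeasure S
            (chainRegion R (startAt o (Fin.snoc p b : Fin (n + 1) → ℝ × ℝ)) (n + 1)) = 0} := by
  have hm : ∀ p : Fin (n + 1) → ℝ × ℝ, MeasurableSet (chainRegion R (startAt o p) (n + 1)) :=
    fun p => measurable_prodMk_left (x := (o, p)) (measurableSet_chainRegion R (n + 1))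
  rw [tupleMeasure_eq_ite hS]
  · refine if_congr ?_ rfl rfl
    rw [blockSeq_insert_eq_some_iff]
    simp only [Set.mem_ofPred_eq, pointMeasure_eq_zero_iff hS (hm _)]
    exact ⟨fun ⟨p, h1, h2⟩ => ⟨p, h2, h1⟩, fun ⟨p, h2, h1⟩ => ⟨p, h1, h2⟩⟩
  · intro p hp p' hp' hpS hpS'
    simp only [Set.mem_ofPred_eq, pointMeasure_eq_zero_iff hS (hm _)] at hp hp'
    have hchain : ∀ p : Fin n → ℝ × ℝ, (∀ i, p i ∈ S) →
        (InReach R (startAt o (Fin.snoc p b : Fin (n + 1) → ℝ × ℝ)) (n + 1) ∧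
            b ∉ chainRegion R (startAt o (Fin.snoc p b : Fin (n + 1) → ℝ × ℝ)) (n + 1)) ∧
          S ∩ chainRegion R (startAt o (Fin.snoc p b : Fin (n + 1) → ℝ × ℝ)) (n + 1) = ∅ →
        IsBlockingChain R (S ∪ {b}) (startAt o (Fin.snoc p b : Fin (n + 1) → ℝ × ℝ)) (n + 1) := by
      intro p hp h
      refine isBlockingChain_startAt_iff.2 ⟨fun i => ?_, h.1.1, ?_⟩
      · refine Fin.lastCases ?_ (fun i => ?_) i
        · rw [Fin.snoc_last]; exact Or.inr rfl
        · rw [Fin.snoc_castSucc]; exact Or.inl (hp i)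
      · rw [Set.union_inter_distrib_right, h.2, Set.empty_union,
          Set.singleton_inter_eq_empty]
        exact h.1.2
    have h := (hchain p hpS hp).unique (hchain p' hpS' hp') (by rw [startAt_zero, startAt_zero])
    ext1 i
    have hi := h (i + 1) (by omega)
    rwa [startAt_snoc _ _ _ i.2, startAt_snoc _ _ _ i.2, startAt_succ, startAt_succ] at hi

open Classical in
theorem lintegral_blockSeq_ne_none (hL : IsPoissonBuildingProcess lam ν P L) (hlam : 0 ≤ lam)
    (o : ℝ × ℝ) :
    ∫⁻ ω, (if blockSeq R (L ω) o n ≠ none then (1 : ℝ≥0∞) else 0) ∂P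
      = ENNReal.ofReal lam ^ n *
        ∫⁻ p, chainWeight lam R ν (o, p) ∂(Measure.pi fun _ : Fin n => 𝔪(ν)) := by
  have hD : MeasurableSet {p : Fin n → ℝ × ℝ | InReach R (startAt o p) n} :=
    (measurable_prodMk_left (x := o)) (measurableSet_inReach R n)
  have hV : MeasurableSet {x : (Fin n → ℝ × ℝ) × (ℝ × ℝ) |
      x.2 ∈ chainRegion R (startAt o x.1) n} :=
    ((measurable_const (a := o)).prodMk measurable_fst).prodMk measurable_snd
      (measurableSet_chainRegion R n)
  have key := hL.lintegral_void hlam hV hD (fun p hp => hp.injective_base)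
    fun p hp => (volume_prod_lt_top (chainRegion_subset hp)).ne
  simp_rw [fun ω => ite_blockSeq_ne_none (R := R) (n := n) (hL.landscape ω) o]
  refine key.trans ?_
  congr 1
  rw [← lintegral_indicator (hD.inter (measurableSet_avoiding hV))]
  rfl

-- Only the `n` intermediate buildings are drawn from the process, hence the power `n` of `lam` for
-- `n + 1` hops. That `b` itself must avoid the void region is a condition on the tuple and goes
-- into the set `D`.
open Classical in
theorem lintegral_blockSeq_insert (hL : IsPoissonBuildingProcess lam ν P L) (hlam : 0 ≤ lam)
    (o b : ℝ × ℝ) :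
    ∫⁻ ω, (if blockSeq R (L ω ∪ {b}) o (n + 1) = some b then (1 : ℝ≥0∞) else 0) ∂P
      = ENNReal.ofReal lam ^ n *
        ∫⁻ p, chainWeight lam R ν (o, (Fin.snoc p b : Fin (n + 1) → ℝ × ℝ))
          ∂(Measure.pi fun _ : Fin n => 𝔪(ν)) := by
  have hsnoc : Measurable fun p : Fin n → ℝ × ℝ => (o, (Fin.snoc p b : Fin (n + 1) → ℝ × ℝ)) := by
    refine measurable_const.prodMk (measurable_pi_lambda _ fun i => ?_)
    refine Fin.lastCases ?_ (fun i => ?_) i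
    · simp only [Fin.snoc_last]; exact measurable_const
    · simp only [Fin.snoc_castSucc]; exact measurable_pi_apply i
  have hV : MeasurableSet {x : (Fin n → ℝ × ℝ) × (ℝ × ℝ) |
      x.2 ∈ chainRegion R (startAt o (Fin.snoc x.1 b : Fin (n + 1) → ℝ × ℝ)) (n + 1)} :=
    ((hsnoc.comp measurable_fst).prodMk measurable_snd) (measurableSet_chainRegion R (n + 1))
  have hD : MeasurableSet {p : Fin n → ℝ × ℝ |
      InReach R (startAt o (Fin.snoc p b : Fin (n + 1) → ℝ × ℝ)) (n + 1) ∧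
        b ∉ chainRegion R (startAt o (Fin.snoc p b : Fin (n + 1) → ℝ × ℝ)) (n + 1)} :=
    (hsnoc (measurableSet_inReach R (n + 1))).inter
      ((measurable_id.prodMk measurable_const) hV).compl
  have key := hL.lintegral_void hlam hV hD (fun p hp i j hij => ?_)
    fun p hp => (volume_prod_lt_top (chainRegion_subset hp.1)).ne
  · simp_rw [fun ω => ite_blockSeq_insert (R := R) (n := n) (hL.landscape ω) o b]
    refine key.trans ?_
    congr 1
    rw [← lintegral_indicator (hD.inter (measurableSet_avoiding hV))]
    refine lintegral_congr fun p => ?_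
    -- The condition on `b` and the avoidance by the other `n` points together say that all `n + 1`
    -- points of the extended tuple avoid the region.
    have hmem : p ∈ {p : Fin n → ℝ × ℝ |
        InReach R (startAt o (Fin.snoc p b : Fin (n + 1) → ℝ × ℝ)) (n + 1) ∧
          b ∉ chainRegion R (startAt o (Fin.snoc p b : Fin (n + 1) → ℝ × ℝ)) (n + 1)} ∩
        avoiding {x : (Fin n → ℝ × ℝ) × (ℝ × ℝ) |
          x.2 ∈ chainRegion R (startAt o (Fin.snoc x.1 b : Fin (n + 1) → ℝ × ℝ)) (n + 1)}
        ↔ (o, (Fin.snoc p b : Fin (n + 1) → ℝ × ℝ)) ∈ freeChains R (n + 1) := by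
      simp only [freeChains, avoiding, Set.mem_inter_iff, Set.mem_ofPred_eq, Fin.forall_fin_succ',
        Fin.snoc_last, Fin.snoc_castSucc]
      tauto
    unfold chainWeight
    by_cases h : (o, (Fin.snoc p b : Fin (n + 1) → ℝ × ℝ)) ∈ freeChains R (n + 1)
    · rw [Set.indicator_of_mem h, Set.indicator_of_mem (hmem.2 h)]
      rfl
    · rw [Set.indicator_of_notMem h, Set.indicator_of_notMem fun h' => h (hmem.1 h')]
  · have h1 := hp.1.injective_base
    have h2 := @h1 i.castSucc j.castSucc (by simpa using hij)
    exact Fin.castSucc_injective n h2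

/-! Translations. -/

/-- The horizontal translation by `c`. -/
def shift (c : ℝ) (q : ℝ × ℝ) : ℝ × ℝ := (q.1 + c, q.2)

theorem measurePreserving_shift (c : ℝ) : MeasurePreserving (shift c) 𝔪(ν) 𝔪(ν) :=
  (measurePreserving_add_right volume c).prod (MeasurePreserving.id ν)

theorem slopeTo_shift (c : ℝ) (p q : ℝ × ℝ) : slopeTo (shift c p) (shift c q) = slopeTo p q := by
  simp [slopeTo, shift]

theorem mem_hopRegion_shift {c : ℝ} {p q r : ℝ × ℝ} :
    shift c r ∈ hopRegion R (shift c p) (shift c q) ↔ r ∈ hopRegion R p q := by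
  simp only [hopRegion, Set.mem_ofPred_eq, slopeTo_shift]
  simp only [shift, add_lt_add_iff_right, add_right_comm p.1 c R, add_le_add_iff_right]

theorem startAt_shift (c : ℝ) (o : ℝ × ℝ) (p : Fin n → ℝ × ℝ) (i : ℕ) :
    startAt (shift c o) (fun j => shift c (p j)) i = shift c (startAt o p i) := by
  unfold startAt
  split_ifs <;> rfl

theorem mem_chainRegion_shift {c : ℝ} {o r : ℝ × ℝ} {p : Fin n → ℝ × ℝ} :
    shift c r ∈ chainRegion R (startAt (shift c o) fun j => shift c (p j)) n
      ↔ r ∈ chainRegion R (startAt o p) n := by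
  simp only [chainRegion, Set.mem_ofPred_eq, startAt_shift, mem_hopRegion_shift]

theorem chainWeight_shift (c : ℝ) (o : ℝ × ℝ) (p : Fin n → ℝ × ℝ) :
    chainWeight lam R ν (shift c o, fun j => shift c (p j)) = chainWeight lam R ν (o, p) := by
  have hmem : ((shift c o, fun j => shift c (p j)) : (ℝ × ℝ) × (Fin n → ℝ × ℝ)) ∈ freeChains R n
      ↔ (o, p) ∈ freeChains R n := by
    simp only [freeChains, Set.mem_ofPred_eq, mem_chainRegion_shift]
    refine and_congr_left fun _ => forall_congr' fun i => forall_congr' fun _ => ?_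
    simp only [startAt_shift]
    simp only [shift, add_lt_add_iff_right, add_right_comm _ c R, add_le_add_iff_right]
  have hvol : 𝔪(ν) (chainRegion R (startAt (shift c o) fun j => shift c (p j)) n)
      = 𝔪(ν) (chainRegion R (startAt o p) n) := by
    have hm : MeasurableSet (chainRegion R (startAt (shift c o) fun j => shift c (p j)) n) :=
      measurable_prodMk_left (x := (shift c o, fun j => shift c (p j)))
        (measurableSet_chainRegion R n)
    rw [← (measurePreserving_shift c).measure_preimage hm.nullMeasurableSet]
    congr 1
    ext r
    exact mem_chainRegion_shift
  unfold chainWeight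
  by_cases h : (o, p) ∈ freeChains R n
  · rw [Set.indicator_of_mem h, Set.indicator_of_mem (hmem.2 h), voidProb, hvol, voidProb]
  · rw [Set.indicator_of_notMem h, Set.indicator_of_notMem fun h' => h (hmem.1 h')]

theorem measurable_snoc : Measurable fun y : (ℝ × ℝ) × (Fin n → ℝ × ℝ) =>
    (Fin.snoc y.2 y.1 : Fin (n + 1) → ℝ × ℝ) := by
  refine measurable_pi_lambda _ fun i => ?_
  refine Fin.lastCases ?_ (fun i => ?_) i
  · simp only [Fin.snoc_last]; exact measurable_fst
  · simp only [Fin.snoc_castSucc]; exact (measurable_pi_apply i).comp measurable_snd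

/-- Mass transport: moving the starting point along the ground amounts to moving the last building
of the chain. -/
theorem lintegral_chainWeight_snoc (lam R : ℝ) (ν : Measure ℝ) [IsProbabilityMeasure ν] (n : ℕ) :
    ∫⁻ x : ℝ, ∫⁻ h, ∫⁻ p, chainWeight lam R ν
        ((x, 0), (Fin.snoc p (0, h) : Fin (n + 1) → ℝ × ℝ))
        ∂(Measure.pi fun _ : Fin n => 𝔪(ν)) ∂ν
      = ∫⁻ p, chainWeight lam R ν ((0, 0), p) ∂(Measure.pi fun _ : Fin (n + 1) => 𝔪(ν)) := by
  have hmeas : Measurable fun y : (ℝ × ℝ) × (Fin n → ℝ × ℝ) =>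
      chainWeight lam R ν ((0, 0), (Fin.snoc y.2 y.1 : Fin (n + 1) → ℝ × ℝ)) :=
    (measurable_chainWeight lam R ν).comp (measurable_const.prodMk measurable_snoc)
  have hshift : ∀ x h : ℝ, ∫⁻ p, chainWeight lam R ν
      ((x, 0), (Fin.snoc p (0, h) : Fin (n + 1) → ℝ × ℝ)) ∂(Measure.pi fun _ : Fin n => 𝔪(ν))
      = ∫⁻ p, chainWeight lam R ν
      ((0, 0), (Fin.snoc p (-x, h) : Fin (n + 1) → ℝ × ℝ)) ∂(Measure.pi fun _ : Fin n => 𝔪(ν)) := by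
    intro x h
    -- Substituting tuples translated by `x`, the starting point `(x, 0)` comes from the origin and
    -- the last building `(0, h)` from `(-x, h)`.
    have hmp := measurePreserving_pi (fun _ : Fin n => 𝔪(ν)) (fun _ : Fin n => 𝔪(ν))
      fun _ => measurePreserving_shift (ν := ν) x
    have hmeas2 : Measurable fun p : Fin n → ℝ × ℝ => chainWeight lam R ν
        ((x, 0), (Fin.snoc p (0, h) : Fin (n + 1) → ℝ × ℝ)) :=
      (measurable_chainWeight lam R ν).comp
        (measurable_const.prodMk (measurable_snoc.comp measurable_prodMk_left))
    rw [← hmp.lintegral_comp hmeas2]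
    refine lintegral_congr fun p => ?_
    rw [← chainWeight_shift x (0, 0)]
    congr 2
    · simp [shift]
    · ext1 i
      refine Fin.lastCases ?_ (fun i => ?_) i
      · simp [shift]
      · simp
  simp_rw [hshift]
  rw [lintegral_neg_eq_self (μ := (volume : Measure ℝ)) fun x : ℝ => ∫⁻ h, ∫⁻ p, chainWeight lam R ν
        ((0, 0), (Fin.snoc p (x, h) : Fin (n + 1) → ℝ × ℝ))
        ∂(Measure.pi fun _ : Fin n => 𝔪(ν)) ∂ν]
  have h1 := lintegral_prod (μ := (volume : Measure ℝ)) (ν := ν)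
    (fun b => ∫⁻ p, chainWeight lam R ν ((0, 0), (Fin.snoc p b : Fin (n + 1) → ℝ × ℝ))
      ∂(Measure.pi fun _ : Fin n => 𝔪(ν))) hmeas.lintegral_prod_right'.aemeasurable
  have h2 := lintegral_prod (μ := 𝔪(ν)) (ν := Measure.pi fun _ : Fin n => 𝔪(ν)) _
    hmeas.aemeasurable
  rw [← h1, ← h2]
  -- The last building and the `n` others are recombined into one tuple of `n + 1` points.
  have hmp := (measurePreserving_piFinSuccAbove (fun _ : Fin (n + 1) => 𝔪(ν)) (Fin.last n)).symm
  have hmeas3 : Measurable fun p : Fin (n + 1) → ℝ × ℝ => chainWeight lam R ν ((0, 0), p) :=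
    (measurable_chainWeight lam R ν).comp measurable_prodMk_left
  rw [← hmp.lintegral_comp hmeas3]
  refine lintegral_congr fun y => ?_
  exact congrArg (fun p => chainWeight lam R ν ((0, 0), p)) (Fin.insertNth_last' y.1 y.2).symm

end

/-! ### Expectations of the ground length and of the number of hops. -/

theorem landscapeSigma_le {Ω : Type*} [mΩ : MeasurableSpace Ω] {L : Ω → Set (ℝ × ℝ)}
    (hm : ∀ B : Set (ℝ × ℝ), MeasurableSet B → Measurable (count L B)) :
    landscapeSigma L ≤ mΩ :=
  iSup₂_le fun B hB => (hm B hB).comap_le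

theorem measurable_count_landscapeSigma {Ω : Type*} (L : Ω → Set (ℝ × ℝ)) {B : Set (ℝ × ℝ)}
    (hB : MeasurableSet B) : Measurable[landscapeSigma L] (count L B) :=
  measurable_iff_comap_le.2 <|
    le_iSup₂ (f := fun (B : Set (ℝ × ℝ)) (_ : MeasurableSet B) =>
      MeasurableSpace.comap (count L B) inferInstance) B hB

theorem lintegral_of_indepFun {Ω E : Type*} [MeasurableSpace Ω] {mE : MeasurableSpace E}
    {P : Measure Ω} [IsProbabilityMeasure P] {X : Ω → E} {H : Ω → ℝ} (hX : Measurable X)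
    (hH : Measurable H) (hind : IndepFun X H P) {F : E × ℝ → ℝ≥0∞} (hF : Measurable F) :
    ∫⁻ ω, F (X ω, H ω) ∂P = ∫⁻ ω, ∫⁻ h, F (X ω, h) ∂(P.map H) ∂P := by
  have := Measure.isProbabilityMeasure_map (μ := P) hH.aemeasurable
  rw [← lintegral_map hF (hX.prodMk hH), (indepFun_iff_map_prod_eq_prod_map_map hX.aemeasurable
    hH.aemeasurable).1 hind, lintegral_prod _ hF.aemeasurable,
    lintegral_map hF.lintegral_prod_right' hX]

/-- Integration of a function of an element independent of `m` and an `m`-measurable one. -/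
theorem lintegral_of_indep {Ω : Type*} {m : MeasurableSpace Ω} [mΩ : MeasurableSpace Ω]
    {P : Measure Ω} [IsProbabilityMeasure P] (hle : m ≤ mΩ) {H : Ω → ℝ}
    (hH : Measurable H) (hindep : Indep (MeasurableSpace.comap H inferInstance) m P)
    {F : Ω × ℝ → ℝ≥0∞} (hF : Measurable[m.prod inferInstance] F) :
    ∫⁻ ω, F (ω, H ω) ∂P = ∫⁻ ω, ∫⁻ h, F (ω, h) ∂(P.map H) ∂P := by
  -- The identity, seen as a random element of `Ω` equipped with the σ-algebra `m`, generates `m`;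
  -- independence of σ-algebras becomes independence of random elements.
  refine lintegral_of_indepFun (mE := m) (X := id) (measurable_id'' hle) hH
    ((@IndepFun_iff_Indep Ω Ω ℝ mΩ m _ id H P).2 ?_) hF
  rw [MeasurableSpace.comap_id]
  exact hindep.symm

section

variable {Ω : Type*} [MeasurableSpace Ω] {L : Ω → Set (ℝ × ℝ)}

open Classical in
theorem measurable_ite_blockSeq_ne_none (R : ℝ) (hL : ∀ ω, IsLandscape (L ω))
    (hm : ∀ B : Set (ℝ × ℝ), MeasurableSet B → Measurable (count L B)) (o : ℝ × ℝ) (n : ℕ) :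
    Measurable fun ω => if blockSeq R (L ω) o n ≠ none then (1 : ℝ≥0∞) else 0 := by
  simp_rw [fun ω => ite_blockSeq_ne_none (R := R) (n := n) (hL ω) o]
  have hconst : Measurable fun p : Fin n → ℝ × ℝ => (o, p) := measurable_const.prodMk measurable_id
  have hV : MeasurableSet {x : (Fin n → ℝ × ℝ) × (ℝ × ℝ) |
      x.2 ∈ chainRegion R (startAt o x.1) n} :=
    ((hconst.comp measurable_fst).prodMk measurable_snd) (measurableSet_chainRegion R n)
  -- `Unit` is a dummy parameter space, as the starting point is fixed here.
  have hD : MeasurableSet {y : (Ω × Unit) × (Fin n → ℝ × ℝ) | InReach R (startAt o y.2) n ∧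
      pointMeasure (L y.1.1) (chainRegion R (startAt o y.2) n) = 0} :=
    ((hconst.comp measurable_snd) (measurableSet_inReach R n)).inter
      ((measurable_fst.fst.prodMk measurable_snd) (measurableSet_void hL hm hV))
  exact (measurable_tupleMeasure hL hm hD).comp (measurable_id.prodMk (measurable_const (a := ())))

open Classical in
/-- The indicator that the ground point of base `x` reaches the added building of base `0` and
height `h` at hop `n + 1`. -/
noncomputable def reachIndicator (R : ℝ) (L : Ω → Set (ℝ × ℝ)) (n : ℕ) (y : (Ω × ℝ) × ℝ) : ℝ≥0∞ :=
  if blockSeq R (L y.1.1 ∪ {(0, y.1.2)}) (y.2, 0) (n + 1) = some (0, y.1.2) then 1 else 0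

/-- Any σ-algebra on `Ω` that makes the counts measurable is allowed: the independence of `H` and
the landscape is exploited later with `landscapeSigma L` in this role. -/
theorem measurable_reachIndicator (R : ℝ) (hL : ∀ ω, IsLandscape (L ω))
    (hm : ∀ B : Set (ℝ × ℝ), MeasurableSet B → Measurable (count L B)) (n : ℕ) :
    Measurable (reachIndicator R L n) := by
  classical
  have hite : reachIndicator R L n = fun y : (Ω × ℝ) × ℝ => _ :=
    funext fun y => ite_blockSeq_insert (R := R) (n := n) (hL y.1.1) (y.2, 0) (0, y.1.2)
  rw [hite]
  have hb : Measurable fun z : (ℝ × ℝ) × (Fin n → ℝ × ℝ) => ((0, z.1.1) : ℝ × ℝ) :=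
    measurable_const.prodMk measurable_fst.fst
  have hsn : Measurable fun z : (ℝ × ℝ) × (Fin n → ℝ × ℝ) =>
      (((z.1.2, 0) : ℝ × ℝ), (Fin.snoc z.2 (0, z.1.1) : Fin (n + 1) → ℝ × ℝ)) :=
    (measurable_fst.snd.prodMk measurable_const).prodMk
      (measurable_snoc.comp (hb.prodMk measurable_snd))
  have hV : MeasurableSet {x : ((ℝ × ℝ) × (Fin n → ℝ × ℝ)) × (ℝ × ℝ) |
      x.2 ∈ chainRegion R (startAt (x.1.1.2, 0)
        (Fin.snoc x.1.2 (0, x.1.1.1) : Fin (n + 1) → ℝ × ℝ)) (n + 1)} :=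
    ((hsn.comp measurable_fst).prodMk measurable_snd) (measurableSet_chainRegion R (n + 1))
  have hD : MeasurableSet {y : (Ω × (ℝ × ℝ)) × (Fin n → ℝ × ℝ) |
      (InReach R (startAt (y.1.2.2, 0) (Fin.snoc y.2 (0, y.1.2.1) : Fin (n + 1) → ℝ × ℝ)) (n + 1) ∧
        ((0, y.1.2.1) : ℝ × ℝ) ∉ chainRegion R (startAt (y.1.2.2, 0)
          (Fin.snoc y.2 (0, y.1.2.1) : Fin (n + 1) → ℝ × ℝ)) (n + 1)) ∧
      pointMeasure (L y.1.1) (chainRegion R (startAt (y.1.2.2, 0)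
          (Fin.snoc y.2 (0, y.1.2.1) : Fin (n + 1) → ℝ × ℝ)) (n + 1)) = 0} := by
    have hz : Measurable fun y : (Ω × (ℝ × ℝ)) × (Fin n → ℝ × ℝ) => (y.1.2, y.2) :=
      measurable_fst.snd.prodMk measurable_snd
    exact (((hsn.comp hz) (measurableSet_inReach R (n + 1))).inter
      (((hz.prodMk (hb.comp hz)) hV).compl)).inter
      ((measurable_fst.fst.prodMk hz) (measurableSet_void hL hm hV))
  exact (measurable_tupleMeasure hL hm hD).comp
    (measurable_fst.fst.prodMk (measurable_fst.snd.prodMk measurable_snd))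

/-- The ground points of the zone are sorted by the hop at which they reach the building. These sets
are disjoint because a chain visits a point at most once, and hop `0` accounts only for the null set
`{0}`. -/
theorem groundLength_zone_eq_tsum (R : ℝ) (hL : ∀ ω, IsLandscape (L ω))
    (hm : ∀ B : Set (ℝ × ℝ), MeasurableSet B → Measurable (count L B)) (ω : Ω) (h : ℝ) :
    groundLength (zone R (L ω ∪ {(0, h)}) (0, h))
      = ∑' n, ∫⁻ x, reachIndicator R L n ((ω, h), x) := by
  classical
  let A : ℕ → Set ℝ := fun n => {x | blockSeq R (L ω ∪ {(0, h)}) (x, 0) (n + 1) = some (0, h)}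
  have hind : ∀ n, (fun x => reachIndicator R L n ((ω, h), x)) = (A n).indicator fun _ => 1 := by
    intro n
    ext x
    simp only [reachIndicator, A, Set.indicator_apply, Set.mem_ofPred_eq]
  have hA : ∀ n, MeasurableSet (A n) := by
    intro n
    have h1 : Measurable fun x => reachIndicator R L n ((ω, h), x) :=
      (measurable_reachIndicator R hL hm n).comp measurable_prodMk_left
    have h2 : A n = (fun x => reachIndicator R L n ((ω, h), x)) ⁻¹' {1} := by
      ext x
      by_cases hx : x ∈ A n <;> simp [hind, hx]
    rw [h2]
    exact h1 (measurableSet_singleton 1)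
  have hlen : ∀ n, ∫⁻ x, reachIndicator R L n ((ω, h), x) = volume (A n) := by
    intro n
    rw [hind, lintegral_indicator_const (hA n), one_mul]
  simp_rw [hlen]
  rw [← measure_iUnion _ hA, groundLength]
  · refine le_antisymm ?_ (measure_mono ?_)
    · have hsub : {x : ℝ | ((x, 0) : ℝ × ℝ) ∈ zone R (L ω ∪ {(0, h)}) (0, h)} ⊆ {0} ∪ ⋃ n, A n := by
        rintro x ⟨-, n, hn⟩
        rcases n with _ | n
        · left
          rw [blockSeq, Option.some_inj] at hn
          exact congrArg Prod.fst hn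
        · exact Or.inr (Set.mem_iUnion.2 ⟨n, hn⟩)
      refine (measure_mono hsub).trans ((measure_union_le _ _).trans ?_)
      rw [Real.volume_singleton, zero_add]
    · intro x hx
      obtain ⟨n, hn⟩ := Set.mem_iUnion.1 hx
      exact ⟨le_rfl, n + 1, hn⟩
  · intro i j hij
    refine Set.disjoint_left.2 fun x hi hj => hij ?_
    have := blockSeq_step_unique hi hj
    omega

end

section

variable {Ω : Type*} [MeasurableSpace Ω] {P : Measure Ω} {lam R : ℝ} {ν : Measure ℝ}
  {L : Ω → Set (ℝ × ℝ)}

theorem IsPoissonBuildingProcess.measurable_hopsBeforeCemetery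
    (hL : IsPoissonBuildingProcess lam ν P L) :
    Measurable fun ω => hopsBeforeCemetery R (L ω) := by
  classical
  simp_rw [hopsBeforeCemetery_eq_tsum]
  exact Measurable.tsum fun n =>
    measurable_ite_blockSeq_ne_none R hL.landscape hL.measurable_count _ _

theorem IsPoissonBuildingProcess.lintegral_hopsBeforeCemetery
    [IsProbabilityMeasure P] [IsProbabilityMeasure ν]
    (hL : IsPoissonBuildingProcess lam ν P L) (hlam : 0 ≤ lam) :
    ∫⁻ ω, hopsBeforeCemetery R (L ω) ∂P = ∑' n : ℕ, ENNReal.ofReal lam ^ (n + 1) *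
      ∫⁻ p, chainWeight lam R ν ((0, 0), p) ∂(Measure.pi fun _ : Fin (n + 1) => 𝔪(ν)) := by
  classical
  simp_rw [hopsBeforeCemetery_eq_tsum]
  rw [lintegral_tsum fun n => (measurable_ite_blockSeq_ne_none R hL.landscape
    hL.measurable_count _ _).aemeasurable]
  exact tsum_congr fun n => lintegral_blockSeq_ne_none hL hlam _

theorem IsPoissonBuildingProcess.measurable_groundLength_zone
    (hL : IsPoissonBuildingProcess lam ν P L) {H : Ω → ℝ} (hH : Measurable H) :
    Measurable fun ω => groundLength (zone R (L ω ∪ {(0, H ω)}) (0, H ω)) := by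
  simp_rw [groundLength_zone_eq_tsum R hL.landscape hL.measurable_count]
  exact Measurable.tsum fun n => (measurable_reachIndicator R hL.landscape
    hL.measurable_count n).lintegral_prod_right'.comp (measurable_id.prodMk hH)

/-- Independence allows `H` to be integrated separately with law `ν`; Tonelli brings the Mecke
formula to each fixed `x` and `h`, and the mass transport identity `lintegral_chainWeight_snoc`
removes them. -/
theorem IsPoissonBuildingProcess.lintegral_groundLength_zone
    [IsProbabilityMeasure P] [IsProbabilityMeasure ν]
    (hL : IsPoissonBuildingProcess lam ν P L) (hlam : 0 ≤ lam) {H : Ω → ℝ} (hH : Measurable H)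
    (hHlaw : P.map H = ν)
    (hindep : Indep (MeasurableSpace.comap H inferInstance) (landscapeSigma L) P) :
    ∫⁻ ω, groundLength (zone R (L ω ∪ {(0, H ω)}) (0, H ω)) ∂P
      = ∑' n : ℕ, ENNReal.ofReal lam ^ n *
        ∫⁻ p, chainWeight lam R ν ((0, 0), p) ∂(Measure.pi fun _ : Fin (n + 1) => 𝔪(ν)) := by
  have hmeas := fun n => measurable_reachIndicator (L := L) R hL.landscape hL.measurable_count n
  simp_rw [groundLength_zone_eq_tsum R hL.landscape hL.measurable_count]
  have hG : ∀ n, Measurable fun ω => ∫⁻ x, reachIndicator R L n ((ω, H ω), x) := fun n =>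
    (hmeas n).lintegral_prod_right'.comp (measurable_id.prodMk hH)
  rw [lintegral_tsum fun n => (hG n).aemeasurable]
  refine tsum_congr fun n => ?_
  have hF : Measurable[(landscapeSigma L).prod inferInstance]
      fun y : Ω × ℝ => ∫⁻ x, reachIndicator R L n (y, x) :=
    @Measurable.lintegral_prod_right' (Ω × ℝ) ℝ ((landscapeSigma L).prod inferInstance) _
      volume _ _ (@measurable_reachIndicator Ω (landscapeSigma L) L R hL.landscape
        (fun B hB => measurable_count_landscapeSigma L hB) n)
  rw [lintegral_of_indep (landscapeSigma_le hL.measurable_count) hH hindep hF, hHlaw,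
    lintegral_lintegral_swap (hmeas n).lintegral_prod_right'.aemeasurable]
  have hswap : ∀ h : ℝ, ∫⁻ ω, (∫⁻ x, reachIndicator R L n ((ω, h), x)) ∂P
      = ∫⁻ x : ℝ, ENNReal.ofReal lam ^ n * ∫⁻ p, chainWeight lam R ν
        ((x, 0), (Fin.snoc p (0, h) : Fin (n + 1) → ℝ × ℝ))
        ∂(Measure.pi fun _ : Fin n => 𝔪(ν)) := by
    intro h
    have hh : Measurable fun y : Ω × ℝ => reachIndicator R L n ((y.1, h), y.2) :=
      (hmeas n).comp ((measurable_fst.prodMk measurable_const).prodMk measurable_snd)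
    rw [lintegral_lintegral_swap hh.aemeasurable]
    exact lintegral_congr fun x => lintegral_blockSeq_insert hL hlam (x, 0) (0, h)
  simp_rw [hswap]
  have hW : Measurable fun y : (ℝ × ℝ) × (Fin n → ℝ × ℝ) => chainWeight lam R ν
      ((y.1.2, 0), (Fin.snoc y.2 (0, y.1.1) : Fin (n + 1) → ℝ × ℝ)) :=
    (measurable_chainWeight lam R ν).comp ((measurable_fst.snd.prodMk measurable_const).prodMk
      (measurable_snoc.comp ((measurable_const.prodMk measurable_fst.fst).prodMk measurable_snd)))
  have hW' : Measurable fun y : ℝ × ℝ => ∫⁻ p, chainWeight lam R ν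
      ((y.2, 0), (Fin.snoc p (0, y.1) : Fin (n + 1) → ℝ × ℝ))
      ∂(Measure.pi fun _ : Fin n => 𝔪(ν)) := hW.lintegral_prod_right'
  rw [lintegral_lintegral_swap (hW'.const_mul _).aemeasurable, ← lintegral_chainWeight_snoc]
  rw [← lintegral_const_mul' _ _ (by finiteness)]
  refine lintegral_congr fun x => ?_
  rw [← lintegral_const_mul' _ _ (by finiteness)]

end

/-! The void region of an admissible chain. -/

theorem lt_slopeTo_iff {p r : ℝ × ℝ} {s : ℝ} (h : p.1 < r.1) :
    s < slopeTo p r ↔ p.2 + s * (r.1 - p.1) < r.2 := by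
  rw [slopeTo, lt_div_iff₀ (sub_pos.2 h)]
  constructor <;> intro h' <;> linarith

theorem snd_eq_add_slopeTo {p q : ℝ × ℝ} (h : p.1 < q.1) :
    q.2 = p.2 + slopeTo p q * (q.1 - p.1) := by
  rw [slopeTo, div_mul_cancel₀ _ (sub_pos.2 h).ne']
  ring

/-- Both sides say that `r` lies above the line through `p` and `q`. -/
theorem slopeTo_lt_slopeTo_iff {p q r : ℝ × ℝ} (hpq : p.1 < q.1) (hqr : q.1 < r.1) :
    slopeTo p q < slopeTo p r ↔ slopeTo p q < slopeTo q r := by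
  rw [lt_slopeTo_iff (hpq.trans hqr), lt_slopeTo_iff hqr, snd_eq_add_slopeTo hpq]
  constructor <;> intro h <;> linarith

theorem Admissible.inReach {R : ℝ} {q : ℕ → ℝ × ℝ} {n : ℕ} (h : Admissible R n q) :
    InReach R q n := fun i hi => h.1 (i + 1) (by omega) hi

theorem Admissible.slope_le {R : ℝ} {q : ℕ → ℝ × ℝ} {n : ℕ} (h : Admissible R n q) {i : ℕ}
    (hi : i + 1 < n) (hr : (q (i + 2)).1 ≤ (q i).1 + R) :
    slopeTo (q (i + 1)) (q (i + 2)) ≤ slopeTo (q i) (q (i + 1)) :=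
  (h.2 (i + 2) (by omega) (by omega)).resolve_right (not_lt.2 hr)

theorem Admissible.of_succ {R : ℝ} {q : ℕ → ℝ × ℝ} {n : ℕ} (h : Admissible R (n + 1) q) :
    Admissible R n q :=
  ⟨fun i h1 h2 => h.1 i h1 (by omega), fun i h1 h2 => h.2 i h1 (by omega)⟩

/-- Beyond the end of hop `k`, the void regions of the earlier hops lie in that of hop `k`. -/
theorem Admissible.mem_hopRegion_of_le {R : ℝ} {q : ℕ → ℝ × ℝ} {n : ℕ} (h : Admissible R n q)
    {j k : ℕ} (hjk : j ≤ k) (hk : k < n) {r : ℝ × ℝ} (hr : r ∈ hopRegion R (q j) (q (j + 1)))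
    (hkr : (q (k + 1)).1 ≤ r.1) : r ∈ hopRegion R (q k) (q (k + 1)) := by
  induction k, hjk using Nat.le_induction with
  | base => exact hr
  | succ k hjk ih =>
    have h1 := h.inReach k (by omega)
    have h2 := h.inReach (k + 1) hk
    have h3 := h2.1.trans_le hkr
    obtain ⟨h4, h5, h6⟩ := ih (by omega) h3.le
    refine ⟨h3, by linarith, Or.inl ?_⟩
    have h7 := h6.resolve_right fun h' => absurd h'.2 (not_lt.2 h3.le)
    -- The point `r` is within range of `q k`, and `q (k + 2)` lies no further, so admissibility
    -- leaves only its slope alternative.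
    exact (h.slope_le hk (hkr.trans h5)).trans_lt ((slopeTo_lt_slopeTo_iff h1.1 h3).1 h7)

/-- Admissibility compares consecutive hops only. It excludes all the void regions because, beyond
the end of a hop, the earlier regions are nested in that of the hop; a point is never in the region
of the hop that leads to it, nor in that of a later one. -/
theorem admissible_iff {R : ℝ} {q : ℕ → ℝ × ℝ} {n : ℕ} :
    Admissible R n q ↔ InReach R q n ∧ ∀ i < n, q (i + 1) ∉ chainRegion R q n := by
  constructor
  · refine fun h => ⟨h.inReach, ?_⟩
    rintro i hi ⟨j, hj, hmem⟩
    by_cases hji : j ≤ i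
    · obtain ⟨-, -, h1 | ⟨-, h1⟩⟩ := h.mem_hopRegion_of_le hji hi hmem le_rfl
      · exact lt_irrefl _ h1
      · exact lt_irrefl _ h1
    · exact absurd hmem.1 (not_lt.2 (h.inReach.base_le (by omega) hj.le))
  · rintro ⟨h, hfree⟩
    refine ⟨fun i h1 h2 => ?_, fun i h1 h2 => ?_⟩
    · obtain ⟨i, rfl⟩ := Nat.exists_eq_add_of_le' h1
      exact h i (by omega)
    · obtain ⟨i, rfl⟩ := Nat.exists_eq_add_of_le' h1
      by_contra hcon
      rw [not_or, not_le, not_lt] at hcon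
      have h3 := h i (by omega)
      have h4 := h (i + 1) (by omega)
      exact hfree (i + 1) (by omega) ⟨i, by omega, h3.1.trans h4.1, hcon.2,
        Or.inl ((slopeTo_lt_slopeTo_iff h3.1 h4.1).2 hcon.1)⟩

/-! Areas with respect to the intensity measure. -/

section

variable {ν : Measure ℝ}

theorem one_sub_cdf [IsProbabilityMeasure ν] (u : ℝ) : 1 - cdf ν u = ν.real (Set.Ioi u) := by
  rw [cdf_eq_real, ← Set.compl_Iic, probReal_compl_eq_one_sub measurableSet_Iic]

theorem antitone_one_sub_cdf (ν : Measure ℝ) : Antitone fun u => 1 - cdf ν u :=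
  fun _ _ h => sub_le_sub_left (monotone_cdf ν h) 1

/-- On `]0, ∞[` this is the layer-cake formula for the finite mean; to the left of `0`, a monotone
function is integrable on a compact interval. -/
theorem integrableOn_one_sub_cdf [IsProbabilityMeasure ν] (hν : ν (Set.Iio 0) = 0)
    (hmean : Integrable (fun h : ℝ => h) ν) (x : ℝ) :
    IntegrableOn (fun u => 1 - cdf ν u) (Set.Ioi x) := by
  have hpos : 0 ≤ᵐ[ν] fun h : ℝ => h := by
    rw [Filter.EventuallyLE, ae_iff]
    simpa [Set.Iio] using hν
  have h0 : IntegrableOn (fun u => 1 - cdf ν u) (Set.Ioi 0) := by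
    refine ⟨(antitone_one_sub_cdf ν).measurable.aestronglyMeasurable, ?_⟩
    rw [hasFiniteIntegral_iff_ofReal (Filter.Eventually.of_forall fun u =>
      sub_nonneg.2 (cdf_le_one ν u))]
    have h1 : ∀ u, ENNReal.ofReal (1 - cdf ν u) = ν {h | u < h} := by
      intro u
      rw [one_sub_cdf, ofReal_measureReal]
      rfl
    simp_rw [h1]
    rw [← lintegral_eq_lintegral_meas_lt ν hpos hmean.aemeasurable]
    exact hmean.lintegral_lt_top
  have h2 : IntegrableOn (fun u => 1 - cdf ν u) (Set.Icc x 0) :=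
    (antitone_one_sub_cdf ν).antitoneOn _ |>.integrableOn_isCompact isCompact_Icc
  refine (h2.union h0).mono_set fun u hu => ?_
  rcases le_or_gt u 0 with h | h
  · exact Or.inl ⟨(Set.mem_Ioi.1 hu).le, h⟩
  · exact Or.inr h

/-- The points with base in `]a, b]` above the line of slope `t` through `(c, h)`. -/
def aboveLine (a b c h t : ℝ) : Set (ℝ × ℝ) :=
  {r | r.1 ∈ Set.Ioc a b ∧ h + t * (r.1 - c) < r.2}

theorem measurableSet_aboveLine (a b c h t : ℝ) : MeasurableSet (aboveLine a b c h t) :=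
  (measurable_fst measurableSet_Ioc).inter
    (measurableSet_lt (((measurable_fst.sub_const c).const_mul t).const_add h) measurable_snd)

theorem aboveLine_lt_top [IsProbabilityMeasure ν] (a b c h t : ℝ) :
    𝔪(ν) (aboveLine a b c h t) < ∞ :=
  volume_prod_lt_top fun _ hr => ⟨hr.1.1.le, hr.1.2⟩

/-- The vertical section over `x` has mass `1 - F` at the height of the line; the affine
substitution along the line, valid for slopes of either sign, gives the division by `t`. -/
theorem measureReal_aboveLine [IsProbabilityMeasure ν] (hν : ν (Set.Iio 0) = 0)
    (hmean : Integrable (fun h : ℝ => h) ν) {a b : ℝ} (hab : a ≤ b) (c h : ℝ) {t : ℝ}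
    (ht : t ≠ 0) :
    (𝔪(ν)).real (aboveLine a b c h t)
      = (tailPrimitive ν (h + t * (b - c)) - tailPrimitive ν (h + t * (a - c))) / t := by
  have hsec : ∀ x, ν (Prod.mk x ⁻¹' aboveLine a b c h t)
      = (Set.Ioc a b).indicator (fun x => ENNReal.ofReal (1 - cdf ν (t * x + (h - t * c)))) x := by
    intro x
    by_cases hx : x ∈ Set.Ioc a b
    · rw [Set.indicator_of_mem hx, one_sub_cdf, ofReal_measureReal]
      congr 1
      ext y
      simp only [aboveLine, Set.mem_preimage, Set.mem_ofPred_eq, hx, true_and, Set.mem_Ioi]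
      rw [show h + t * (x - c) = t * x + (h - t * c) by ring]
    · rw [Set.indicator_of_notMem hx]
      convert measure_empty (μ := ν)
      ext y
      exact iff_of_false (fun h => hx h.1) (Set.notMem_empty y)
  have hmeas : Measurable fun x => 1 - cdf ν (t * x + (h - t * c)) :=
    (antitone_one_sub_cdf ν).measurable.comp ((measurable_id.const_mul t).add_const _)
  rw [measureReal_def, Measure.prod_apply (measurableSet_aboveLine a b c h t)]
  simp_rw [hsec]
  rw [lintegral_indicator measurableSet_Ioc, ← integral_eq_lintegral_of_nonneg_ae
    (Filter.Eventually.of_forall fun x => sub_nonneg.2 (cdf_le_one ν _))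
    hmeas.aestronglyMeasurable, ← intervalIntegral.integral_of_le hab,
    intervalIntegral.integral_comp_mul_add (fun u => 1 - cdf ν u) ht,
    ← intervalIntegral.integral_Ioi_sub_Ioi' (integrableOn_one_sub_cdf hν hmean _)
      (integrableOn_one_sub_cdf hν hmean _), tailPrimitive, tailPrimitive, smul_eq_mul]
  rw [show t * a + (h - t * c) = h + t * (a - c) by ring,
    show t * b + (h - t * c) = h + t * (b - c) by ring]
  field_simp
  ring

theorem measurableSet_hopRegion_fixed (R : ℝ) (p q : ℝ × ℝ) : MeasurableSet (hopRegion R p q) :=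
  measurable_prodMk_left (x := (p, q)) (measurableSet_hopRegion R)

theorem aboveLine_subset_hopRegion (R : ℝ) (p q : ℝ × ℝ) :
    aboveLine p.1 (p.1 + R) p.1 p.2 (slopeTo p q) ⊆ hopRegion R p q :=
  fun _ hr => ⟨hr.1.1, hr.1.2, Or.inl ((lt_slopeTo_iff hr.1.1).2 hr.2)⟩

/-- The difference lies on the line through `p` and `q`, so each vertical section has at most one
point. This removes the tie-break from the areas. -/
theorem measure_hopRegion_diff_aboveLine [NullSingletonClass ν] [SFinite ν] (R : ℝ) (p q : ℝ × ℝ) :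
    𝔪(ν) (hopRegion R p q \ aboveLine p.1 (p.1 + R) p.1 p.2 (slopeTo p q)) = 0 := by
  have hm := (measurableSet_hopRegion_fixed R p q).diff
    (measurableSet_aboveLine p.1 (p.1 + R) p.1 p.2 (slopeTo p q))
  rw [Measure.measure_prod_null hm]
  refine Filter.Eventually.of_forall fun x => measure_mono_null (fun y hy => ?_)
    (measure_singleton (μ := ν) (p.2 + slopeTo p q * (x - p.1)))
  obtain ⟨⟨h1, h2, h3 | ⟨h3, -⟩⟩, h4⟩ := hy
  · exact absurd ⟨⟨h1, h2⟩, (lt_slopeTo_iff h1).1 h3⟩ h4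
  · have := snd_eq_add_slopeTo h1
    rw [← h3] at this
    exact this

theorem measureReal_hopRegion_diff [NullSingletonClass ν] [SFinite ν] (R : ℝ) (p q : ℝ × ℝ)
    (B : Set (ℝ × ℝ)) : (𝔪(ν)).real (hopRegion R p q \ B)
      = (𝔪(ν)).real (aboveLine p.1 (p.1 + R) p.1 p.2 (slopeTo p q) \ B) := by
  refine congrArg ENNReal.toReal (le_antisymm ?_
    (measure_mono (Set.sdiff_subset_sdiff_left (aboveLine_subset_hopRegion R p q))))
  have hsub : hopRegion R p q \ B ⊆ (aboveLine p.1 (p.1 + R) p.1 p.2 (slopeTo p q) \ B) ∪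
      (hopRegion R p q \ aboveLine p.1 (p.1 + R) p.1 p.2 (slopeTo p q)) := by
    intro r hr
    by_cases h : r ∈ aboveLine p.1 (p.1 + R) p.1 p.2 (slopeTo p q)
    · exact Or.inl ⟨h, hr.2⟩
    · exact Or.inr ⟨hr.1, h⟩
  refine (measure_mono hsub).trans ((measure_union_le _ _).trans ?_)
  rw [measure_hopRegion_diff_aboveLine R p q, add_zero]

theorem chainRegion_succ (R : ℝ) (q : ℕ → ℝ × ℝ) (n : ℕ) :
    chainRegion R q (n + 1) = chainRegion R q n ∪ hopRegion R (q n) (q (n + 1)) := by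
  ext r
  constructor
  · rintro ⟨i, hi, hr⟩
    rcases Nat.lt_succ_iff_lt_or_eq.1 hi with h | rfl
    · exact Or.inl ⟨i, h, hr⟩
    · exact Or.inr hr
  · rintro (⟨i, hi, hr⟩ | hr)
    · exact ⟨i, by omega, hr⟩
    · exact ⟨n, by omega, hr⟩

theorem measurableSet_chainRegion_fixed (R : ℝ) (q : ℕ → ℝ × ℝ) (n : ℕ) :
    MeasurableSet (chainRegion R q n) := by
  induction n with
  | zero =>
    convert MeasurableSet.empty
    ext r
    simp [chainRegion]
  | succ n ih =>
    rw [chainRegion_succ]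
    exact ih.union (measurableSet_hopRegion_fixed _ _ _)

/-- Over the common range `]a, b]`, being above one of two lines through the same point means being
above the lower one; this is the origin of the minima `mᵢ`. -/
theorem aboveLine_union {a b b' h t t' : ℝ} (hab : a ≤ b) (hbb : b ≤ b') :
    aboveLine a b' a h t' ∪ aboveLine a b a h t
      = aboveLine a b a h (min t t') ∪ aboveLine b b' a h t' := by
  have key : ∀ r : ℝ × ℝ, a < r.1 → (h + min t t' * (r.1 - a) < r.2 ↔
      h + t * (r.1 - a) < r.2 ∨ h + t' * (r.1 - a) < r.2) := by
    intro r hr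
    rw [min_mul_of_nonneg _ _ (sub_pos.2 hr).le, ← min_add_add_left, min_lt_iff]
  ext r
  simp only [aboveLine, Set.mem_union, Set.mem_ofPred_eq, Set.mem_Ioc]
  constructor
  · rintro (⟨⟨h1, h2⟩, h3⟩ | ⟨⟨h1, h2⟩, h3⟩)
    · rcases le_or_gt r.1 b with h4 | h4
      · exact Or.inl ⟨⟨h1, h4⟩, (key r h1).2 (Or.inr h3)⟩
      · exact Or.inr ⟨⟨h4, h2⟩, h3⟩
    · exact Or.inl ⟨⟨h1, h2⟩, (key r h1).2 (Or.inl h3)⟩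
  · rintro (⟨⟨h1, h2⟩, h3⟩ | ⟨⟨h1, h2⟩, h3⟩)
    · rcases (key r h1).1 h3 with h4 | h4
      · exact Or.inr ⟨⟨h1, h2⟩, h4⟩
      · exact Or.inl ⟨⟨h1, h2.trans hbb⟩, h4⟩
    · exact Or.inl ⟨⟨hab.trans_lt h1, h2⟩, h3⟩

/-- The part of the void region of hop `n + 1` that is new. -/
theorem Admissible.hopRegion_diff_chainRegion {R : ℝ} {q : ℕ → ℝ × ℝ} {n : ℕ}
    (h : Admissible R (n + 2) q) :
    hopRegion R (q (n + 1)) (q (n + 2)) \ chainRegion R q (n + 1)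
      = hopRegion R (q (n + 1)) (q (n + 2)) \ aboveLine (q (n + 1)).1 ((q n).1 + R) (q (n + 1)).1
          (q (n + 1)).2 (slopeTo (q n) (q (n + 1))) := by
  have h1 := (h.inReach n (by omega)).1
  ext r
  refine and_congr_right fun hr => not_congr ⟨?_, fun hr' => ?_⟩
  · rintro ⟨j, hj, hrj⟩
    obtain ⟨-, h3, h4⟩ := h.mem_hopRegion_of_le (k := n) (by omega) (by omega) hrj hr.1.le
    have h5 := h4.resolve_right fun h' => absurd h'.2 (not_lt.2 hr.1.le)
    exact ⟨⟨hr.1, h3⟩, (lt_slopeTo_iff hr.1).1 ((slopeTo_lt_slopeTo_iff h1 hr.1).1 h5)⟩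
  · exact ⟨n, by omega, h1.trans hr.1, hr'.1.2, Or.inl
      ((slopeTo_lt_slopeTo_iff h1 hr.1).2 ((lt_slopeTo_iff hr.1).2 hr'.2))⟩

/-- The new part is the region above the new line minus the region above the old one over the
leftover range. `aboveLine_union` gives the area of the union of these two regions, and the area of
the old one is moved to the left-hand side. -/
theorem Admissible.measureReal_chainRegion_succ [IsProbabilityMeasure ν]
    [NullSingletonClass ν] {R : ℝ}
    {q : ℕ → ℝ × ℝ} {n : ℕ} (h : Admissible R (n + 2) q) :
    (𝔪(ν)).real (chainRegion R q (n + 2)) + (𝔪(ν)).real (aboveLine (q (n + 1)).1 ((q n).1 + R)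
        (q (n + 1)).1 (q (n + 1)).2 (slopeTo (q n) (q (n + 1))))
      = (𝔪(ν)).real (chainRegion R q (n + 1))
        + (𝔪(ν)).real (aboveLine (q (n + 1)).1 ((q n).1 + R) (q (n + 1)).1 (q (n + 1)).2
          (min (slopeTo (q n) (q (n + 1))) (slopeTo (q (n + 1)) (q (n + 2)))))
        + (𝔪(ν)).real (aboveLine ((q n).1 + R) ((q (n + 1)).1 + R) (q (n + 1)).1 (q (n + 1)).2
          (slopeTo (q (n + 1)) (q (n + 2)))) := by
  have h1 := h.inReach n (by omega)
  have hfin : 𝔪(ν) (chainRegion R q (n + 1)) ≠ ∞ :=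
    (volume_prod_lt_top (chainRegion_subset h.of_succ.inReach)).ne
  have hfin' : ∀ p p' : ℝ × ℝ, 𝔪(ν) (hopRegion R p p') ≠ ∞ := fun p p' =>
    (volume_prod_lt_top (a := p.1) (b := p.1 + R) fun r hr => ⟨hr.1.le, hr.2.1⟩).ne
  set B := aboveLine (q (n + 1)).1 ((q n).1 + R) (q (n + 1)).1 (q (n + 1)).2
    (slopeTo (q n) (q (n + 1))) with hB
  have hBm : MeasurableSet B := measurableSet_aboveLine _ _ _ _ _
  set W := hopRegion R (q (n + 1)) (q (n + 2))
  set U := aboveLine (q (n + 1)).1 ((q (n + 1)).1 + R) (q (n + 1)).1 (q (n + 1)).2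
    (slopeTo (q (n + 1)) (q (n + 2))) with hU
  have hUm : MeasurableSet U := measurableSet_aboveLine _ _ _ _ _
  have hWB : (𝔪(ν)).real (W \ B) = (𝔪(ν)).real (U \ B) := measureReal_hopRegion_diff _ _ _ _
  have hsum1 : (𝔪(ν)).real (chainRegion R q (n + 2))
      = (𝔪(ν)).real (chainRegion R q (n + 1)) + (𝔪(ν)).real (U \ B) := by
    rw [← hWB, ← h.hopRegion_diff_chainRegion, chainRegion_succ, ← Set.union_sdiff_self]
    exact measureReal_union Set.disjoint_sdiff_right
      ((measurableSet_hopRegion_fixed _ _ _).diff (measurableSet_chainRegion_fixed _ _ _)) hfin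
      (measure_ne_top_of_subset Set.sdiff_subset (hfin' _ _))
  have hsum2 : (𝔪(ν)).real (U ∪ B) = (𝔪(ν)).real (U \ B) + (𝔪(ν)).real B := by
    rw [← Set.sdiff_union_self]
    exact measureReal_union Set.disjoint_sdiff_left hBm
      (measure_ne_top_of_subset Set.sdiff_subset (aboveLine_lt_top _ _ _ _ _).ne)
      (aboveLine_lt_top _ _ _ _ _).ne
  rw [hU, hB, aboveLine_union h1.2 (by linarith [h1.1]), measureReal_union
    (Set.disjoint_left.2 fun r hr hr' => absurd hr.1.2 (not_le.2 hr'.1.1))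
    (measurableSet_aboveLine _ _ _ _ _) (aboveLine_lt_top _ _ _ _ _).ne
    (aboveLine_lt_top _ _ _ _ _).ne] at hsum2
  rw [hsum1]
  linarith

theorem densityExponent_succ (R : ℝ) (ν : Measure ℝ) (n : ℕ) (q : ℕ → ℝ × ℝ) :
    densityExponent R ν (n + 2) q = densityExponent R ν (n + 1) q
      + (tailPrimitive ν ((q (n + 1)).2 + R * hopSlope q (n + 2)) / hopSlope q (n + 2)
        - tailPrimitive ν ((q n).2 + R * hopSlope q (n + 1)) / hopSlope q (n + 1))
      + tailPrimitive ν (q (n + 1)).2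
        * (1 / hopSlope q (n + 1) - 1 / min (hopSlope q (n + 1)) (hopSlope q (n + 2)))
      + (tailPrimitive ν ((q (n + 1)).2 + leftover R q (n + 1)
            * min (hopSlope q (n + 1)) (hopSlope q (n + 2)))
          / min (hopSlope q (n + 1)) (hopSlope q (n + 2))
        - tailPrimitive ν ((q (n + 1)).2 + leftover R q (n + 1) * hopSlope q (n + 2))
          / hopSlope q (n + 2)) := by
  simp only [densityExponent]
  have hsum : ∀ f : ℕ → ℝ, ∑ i ∈ Finset.Ico 1 (n + 2), f i
      = ∑ i ∈ Finset.Ico 1 (n + 1), f i + f (n + 1) :=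
    fun f => Finset.sum_Ico_succ_top (by omega) f
  rw [hsum, hsum]
  simp only [show n + 2 - 1 = n + 1 by omega, show n + 1 - 1 = n by omega,
    show n + 1 + 1 = n + 2 by omega]
  ring

/-- The intensity of the void region of an admissible chain. -/
theorem Admissible.measureReal_chainRegion [IsProbabilityMeasure ν] [NullSingletonClass ν]
    (hν : ν (Set.Iio 0) = 0) (hmean : Integrable (fun h : ℝ => h) ν) {R : ℝ} (hR : 0 < R)
    {q : ℕ → ℝ × ℝ} {n : ℕ} (h : Admissible R (n + 1) q)
    (ht : ∀ i ≤ n, slopeTo (q i) (q (i + 1)) ≠ 0) :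
    (𝔪(ν)).real (chainRegion R q (n + 1)) = densityExponent R ν (n + 1) q := by
  induction n with
  | zero =>
    have hset : chainRegion R q 1 = hopRegion R (q 0) (q 1) := by
      ext r; simp [chainRegion]
    have hm := measureReal_hopRegion_diff (ν := ν) R (q 0) (q 1) ∅
    rw [Set.sdiff_empty, Set.sdiff_empty] at hm
    rw [zero_add, hset, hm, measureReal_aboveLine hν hmean (by linarith) _ _ (ht 0 le_rfl)]
    simp only [densityExponent, hopSlope, Finset.Ico_self, Finset.sum_empty, Nat.sub_self]
    rw [add_sub_cancel_left, sub_self, mul_zero, add_zero, mul_comm R]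
    ring
  | succ n ih =>
    have ih' := ih h.of_succ fun i hi => ht i (by omega)
    have h1 := h.inReach n (by omega)
    have ht1 := ht n (by omega)
    have ht2 := ht (n + 1) le_rfl
    have ht3 : min (slopeTo (q n) (q (n + 1))) (slopeTo (q (n + 1)) (q (n + 2))) ≠ 0 := by
      rcases min_choice (slopeTo (q n) (q (n + 1))) (slopeTo (q (n + 1)) (q (n + 2))) with h' | h'
      · rw [h']; exact ht1
      · rw [h']; exact ht2
    have key := h.measureReal_chainRegion_succ (ν := ν)
    rw [measureReal_aboveLine hν hmean h1.2 _ _ ht1, measureReal_aboveLine hν hmean h1.2 _ _ ht3,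
      measureReal_aboveLine hν hmean (by linarith [h1.1]) _ _ ht2, ih'] at key
    rw [densityExponent_succ]
    have hs1 : hopSlope q (n + 1) = slopeTo (q n) (q (n + 1)) := rfl
    have hs2 : hopSlope q (n + 2) = slopeTo (q (n + 1)) (q (n + 2)) := rfl
    have hl : leftover R q (n + 1) = (q n).1 + R - (q (n + 1)).1 := by
      simp only [leftover, Nat.add_sub_cancel]
      ring
    -- The line of the previous hop at the end of its range, computed from either end of the hop:
    -- the final term of the previous exponent cancels.
    have hh : (q n).2 + R * slopeTo (q n) (q (n + 1))
        = (q (n + 1)).2 + slopeTo (q n) (q (n + 1)) * ((q n).1 + R - (q (n + 1)).1) := by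
      rw [snd_eq_add_slopeTo h1.1]
      ring
    rw [hs1, hs2, hl, hh]
    generalize slopeTo (q n) (q (n + 1)) = t at *
    generalize slopeTo (q (n + 1)) (q (n + 2)) = t' at *
    rw [sub_self, mul_zero, mul_zero, add_zero, add_sub_cancel_left] at key
    rw [mul_comm R t', mul_comm _ (min t t'), mul_comm _ t']
    generalize min t t' = m at *
    simp only [sub_div] at key
    rw [mul_sub (tailPrimitive ν (q (n + 1)).2), mul_one_div, mul_one_div]
    change (𝔪(ν)).real (chainRegion R q (n + 2)) = _
    linarith

end

/-! ### Identification of the density. -/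

section

variable {ν : Measure ℝ}

/-- With the other coordinates fixed, the height of point `i` would have to take one prescribed
value, which has probability zero without atoms. -/
theorem measure_snd_eq_comp [IsProbabilityMeasure ν] [NullSingletonClass ν] {n : ℕ}
    (i : Fin (n + 1))
    {f : (Fin n → ℝ × ℝ) → ℝ} (hf : Measurable f) :
    (Measure.pi fun _ : Fin (n + 1) => 𝔪(ν))
      {p | (p i).2 = f fun j => p (i.succAbove j)} = 0 := by
  have hmp := measurePreserving_piFinSuccAbove (fun _ : Fin (n + 1) => 𝔪(ν)) i
  have hs : MeasurableSet {y : (ℝ × ℝ) × (Fin n → ℝ × ℝ) | y.1.2 = f y.2} :=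
    measurableSet_eq_fun measurable_fst.snd (hf.comp measurable_snd)
  have h0 : ((𝔪(ν)).prod (Measure.pi fun _ : Fin n => 𝔪(ν)))
      {y : (ℝ × ℝ) × (Fin n → ℝ × ℝ) | y.1.2 = f y.2} = 0 := by
    rw [Measure.prod_apply_symm hs]
    refine (lintegral_congr fun p => ?_).trans lintegral_zero
    have : (fun x : ℝ × ℝ => (x, p)) ⁻¹' {y : (ℝ × ℝ) × (Fin n → ℝ × ℝ) | y.1.2 = f y.2}
        = Set.univ ×ˢ {f p} := by
      ext x; simp
    rw [this, Measure.prod_prod, measure_singleton, mul_zero]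
  have h1 := hmp.measure_preimage hs.nullMeasurableSet
  rw [h0] at h1
  exact h1

/-- Without atoms, almost no tuple has a hop of slope zero. -/
theorem ae_snd_ne_startAt [IsProbabilityMeasure ν] [NullSingletonClass ν] (n : ℕ) :
    ∀ᵐ p ∂(Measure.pi fun _ : Fin n => 𝔪(ν)), ∀ i : Fin n,
      (p i).2 ≠ (startAt (0, 0) p i).2 := by
  rw [ae_all_iff]
  intro i
  rw [ae_iff]
  simp only [not_not]
  obtain ⟨m, rfl⟩ : ∃ m, n = m + 1 := ⟨n - 1, by have := i.2; omega⟩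
  -- Since `p i` is term `i + 1` of the sequence, `startAt (0, 0) p i` is its predecessor: the
  -- origin for the first point, otherwise the preceding entry of the tuple.
  refine Fin.cases ?_ (fun j => ?_) i
  · refine (measure_mono_null ?_ (measure_snd_eq_comp (ν := ν) (0 : Fin (m + 1))
      (measurable_const (a := (0 : ℝ)))))
    intro p hp
    have hp' : (p 0).2 = (startAt (0, 0) p 0).2 := hp
    rwa [startAt_zero] at hp'
  · obtain ⟨k, hk⟩ := Fin.exists_succAbove_eq (x := j.castSucc) (y := j.succ)
      (Fin.castSucc_lt_succ).ne
    refine (measure_mono_null ?_ (measure_snd_eq_comp (ν := ν) j.succ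
      (f := fun p => (p k).2) (measurable_pi_apply k).snd))
    intro p hp
    have hp' : (p j.succ).2 = (startAt (0, 0) p (j + 1)).2 := by simpa using hp
    have h1 := startAt_succ (0, 0) p j.castSucc
    rw [Fin.val_castSucc] at h1
    rw [h1] at hp'
    change (p j.succ).2 = (p (j.succ.succAbove k)).2
    rw [hk]
    exact hp'

theorem mem_freeChains_iff {R : ℝ} {n : ℕ} {p : Fin n → ℝ × ℝ} :
    ((0, 0), p) ∈ freeChains R n ↔ Admissible R n (fromOrigin p) := by
  rw [admissible_iff]
  refine and_congr_right fun _ => ⟨fun h i hi => ?_, fun h i => ?_⟩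
  -- `fromOrigin` unfolds to `startAt (0, 0)`.
  · change startAt (0, 0) p (i + 1) ∉ _
    rw [startAt_succ (0, 0) p ⟨i, hi⟩]
    exact h ⟨i, hi⟩
  · change p i ∉ _
    rw [← startAt_succ (0, 0) p i]
    exact h i i.2

theorem blockDensity_eq [IsProbabilityMeasure ν] [NullSingletonClass ν]
    (hν : ν (Set.Iio 0) = 0) (hmean : Integrable (fun h : ℝ => h) ν) {lam R : ℝ} (hlam : 0 ≤ lam)
    (hR : 0 < R) {n : ℕ} {p : Fin (n + 1) → ℝ × ℝ}
    (hp : ∀ i : Fin (n + 1), (p i).2 ≠ (startAt (0, 0) p i).2) :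
    blockDensity lam R ν (n + 1) p
      = ENNReal.ofReal lam ^ (n + 1) * chainWeight lam R ν ((0, 0), p) := by
  unfold blockDensity chainWeight
  split_ifs with h
  · rw [Set.indicator_of_mem (mem_freeChains_iff.2 h), voidProb,
      ← ENNReal.ofReal_pow hlam, ← ENNReal.ofReal_mul (by positivity),
      ← h.measureReal_chainRegion hν hmean hR]
    · rfl
    · intro i hi
      have h1 := h.inReach i (by omega)
      have h2 := hp ⟨i, by omega⟩
      have h3 := startAt_succ (0, 0) p ⟨i, by omega⟩
      rw [← h3] at h2
      exact div_ne_zero (sub_ne_zero.2 h2) (sub_pos.2 h1.1).ne'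
  · rw [Set.indicator_of_notMem fun h' => h (mem_freeChains_iff.1 h'), mul_zero]

end

end Relay

/-! ### Conclusion: termwise comparison of the series. -/

theorem mainTheorem11 {Ω : Type*} [MeasurableSpace Ω] (P : Measure Ω) [IsProbabilityMeasure P]
    (lam R : ℝ) (hlam : 0 < lam) (hR : 0 < R)
    -- the height distribution: a probability measure on `ℝ₊` with finite mean
    (ν : Measure ℝ) [IsProbabilityMeasure ν] (hν : ν (Set.Iio 0) = 0)
    (hmean : Integrable (fun h : ℝ => h) ν)
    -- the Poisson building process and the independent height of the typical building
    (L : Ω → Set (ℝ × ℝ)) (hL : Relay.IsPoissonBuildingProcess lam ν P L)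
    (H : Ω → ℝ) (hH : Measurable H) (hHlaw : P.map H = ν)
    (hindep : Indep (MeasurableSpace.comap H inferInstance) (Relay.landscapeSigma L) P) :
    AEMeasurable
      (fun ω => Relay.groundLength (Relay.zone R (L ω ∪ {(0, H ω)}) (0, H ω))) P ∧
    AEMeasurable (fun ω => Relay.hopsBeforeCemetery R (L ω)) P ∧
    ∫⁻ ω, Relay.groundLength (Relay.zone R (L ω ∪ {(0, H ω)}) (0, H ω)) ∂P
      = (ENNReal.ofReal lam)⁻¹ * ∫⁻ ω, Relay.hopsBeforeCemetery R (L ω) ∂P ∧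
    ((∀ h : ℝ, ν {h} = 0) →
      ∫⁻ ω, Relay.hopsBeforeCemetery R (L ω) ∂P
        = ∑' n : ℕ, ∫⁻ p : Fin (n + 1) → ℝ × ℝ, Relay.blockDensity lam R ν (n + 1) p
            ∂(Measure.pi fun _ : Fin (n + 1) => (volume : Measure ℝ).prod ν)) := by
  have h1 := hL.lintegral_groundLength_zone (R := R) hlam.le hH hHlaw hindep
  have h2 := hL.lintegral_hopsBeforeCemetery (R := R) hlam.le
  refine ⟨(hL.measurable_groundLength_zone hH).aemeasurable,
    hL.measurable_hopsBeforeCemetery.aemeasurable, ?_, fun hatom => ?_⟩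
  · rw [h1, h2, ← ENNReal.tsum_mul_left]
    refine tsum_congr fun n => ?_
    -- The series for the hops has one more factor `lam` in each term, for the last building of the
    -- chain.
    rw [pow_succ', ← mul_assoc, ← mul_assoc, ENNReal.inv_mul_cancel
      (ENNReal.ofReal_pos.2 hlam).ne' ENNReal.ofReal_ne_top, one_mul]
  · have : NullSingletonClass ν := ⟨hatom⟩
    rw [h2]
    refine tsum_congr fun n => ?_
    rw [← lintegral_const_mul' _ _ (by finiteness)]
    refine lintegral_congr_ae ?_
    filter_upwards [Relay.ae_snd_ne_startAt (ν := ν) (n + 1)] with p hp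
    exact (Relay.blockDensity_eq hν hmean hlam.le hR hp).symm
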